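/- **Setting.** Let $G$ be a graph on $n$ ordered vertices, $k\ge 1$, and let $S_k$ be the set of $k$-simplices of the clique complex of $G$ (cliques with $k+1$ vertices), assumed non-empty. Let $\partial_k$ be the simplicial boundary maps, $\beta_k=\dim_{\mathbb C}(\ker\partial_k/\operatorname{im}\partial_{k+1})$, $\Delta_k=\partial_k^\dagger\partial_k+\partial_{k+1}\partial_{k+1}^\dagger$, $\tilde\Delta_k=\Delta_k/n$, $H=I-\tilde\Delta_k$, and let $\|H\|_1$ be the largest absolute column sum of $H$. Let $\delta>0$ be a lower bound for the positive eigenvalues of $\tilde\Delta_k$, and let $0<\epsilon\le 1$ and $0<\eta<1$. *Trace estimation.* The randomised algorithms access $H$ only through a uniform sampler of $S_k$ and through queries that return a row of $H$ as a dictionary of its nonzero entries. A sample of $Y_i$ is obtained by choosing $x_0\in S_k$ uniformly, running $i$ steps of the Markov chain with transition probabilities $|H_{xy}|/\|H_{x,\cdot}\|_1$ (one row query per step), and returning $\prod_{j<i}\operatorname{sign}(H_{x_jx_{j+1}})\|H_{x_j,\cdot}\|_1$ if $x_i=x_0$, and $0$ otherwise. $\mathrm{Est}(i,q)$ is the mean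 of $q$ independent samples of $Y_i$ ($0$ if $q=0$). Put $q(R,\epsilon,\eta)=\left\lceil (2R)^2\log(2/\eta)/(2\epsilon^2)\right\rceil$. *CBNE-Power.* With $d=\lceil\log(2/\epsilon)/\delta\rceil$, return $\mathrm{Est}(d,\,q(R,\epsilon/2,\eta))$, where either (a) $R=\|H\|_1^d$ or (b) $R=2^d$. *CBNE-Chebyshev* (for $\delta<1$). With $d=\lceil\log(4/\epsilon)/\sqrt\delta\rceil$ and $p(x)=T_d\!\left(\frac{x}{1-\delta}\right)/T_d\!\left(\frac1{1-\delta}\right)=\sum_i a_ix^i$, where $T_d$ is the Chebyshev polynomial of the first kind, put $\|p\|_2^2=\sum_i a_i^2$, $\eta'=1-(1-\eta)^{1/\lceil d/2\rceil}$ and $\epsilon_i=\epsilon/(2\lceil d/2\rceil|a_i|)$. Return $a_0+\sum_{i=1}^d a_i\,\hat\mu_i$ with independent $\hat\mu_i=\mathrm{Est}(i,\,q(R_i,\epsilon_i,\eta'))$ (no samples if $a_i=0$), where either (a) $R_i=\|H\|_1^i$ or (b) $R_i=2^d$. **Theorem.** There are absolute constants $C,c$ and polynomials $P,Q$ in three variables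 such that for all $n,k,G,\delta,\epsilon,\eta$ as above the following holds. 1. $\|H\|_1\le 2$. 2. Both versions of CBNE-Power output $\hat\beta$ with $\Pr[|\hat\beta-\beta_k/|S_k||\ge\epsilon]\le\eta$. In every run, the number $S$ of row queries satisfies, for version (a), $$S\le C\log\tfrac2\eta\cdot\frac{\log(2/\epsilon)}{\delta}\cdot\max\!\left(1,\frac{\|H\|_1^{2\log(2/\epsilon)/\delta}}{\epsilon^2}\right),$$ and, for both versions, $$S\le C\log\tfrac2\eta\cdot\frac{\log(2/\epsilon)}{\delta}\cdot\frac{2^{2\log(2/\epsilon)/\delta}}{\epsilon^2},\qquad S\le\log\tfrac2\eta\cdot P\!\left(n,\tfrac1\epsilon,\tfrac1\delta\right)2^{c\log(2/\epsilon)/\delta}.$$ 3. If $\delta<1$, both versions of CBNE-Chebyshev output $\hat\beta$ with $\Pr[|\hat\beta-\beta_k/|S_k||\ge\epsilon]\le\eta$. In every run, the number $S$ of row queries satisfies $$S\le C\log\tfrac2\eta\cdot\frac{(\log(4/\epsilon))^4}{\delta^2}\cdot\frac{\|p\|_2^2\,B^{2\log(4/\epsilon)/\sqrt\delta}}{\epsilon^2},\qquad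 S\le\log\tfrac2\eta\cdot Q\!\left(n,\tfrac1\epsilon,\tfrac1\delta\right)2^{c\log(4/\epsilon)/\sqrt\delta},$$ where $B=\max(1,\|H\|_1)$ for version (a) and $B=2$ for version (b). In particular, for fixed $\eta$ and whenever $\|H\|_1\ge1$, version (a) of CBNE-Power makes $O\!\left(\frac{\log(2/\epsilon)}{\delta}\frac{\|H\|_1^{2\log(2/\epsilon)/\delta}}{\epsilon^2}\right)$ queries and version (a) of CBNE-Chebyshev makes $O\!\left(\frac{(\log(4/\epsilon))^4}{\delta^2}\frac{\|p\|_2^2\|H\|_1^{2\log(4/\epsilon)/\sqrt\delta}}{\epsilon^2}\right)$ queries. -/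

import Mathlib

open scoped Matrix

/-! ### Clique complexes, Laplacians and Betti numbers -/

/-- The cliques of `G` with exactly `c` vertices. -/
abbrev CliqueOfCard {n : ℕ} (G : SimpleGraph (Fin n)) (c : ℕ) : Type :=
  {s : Finset (Fin n) // G.IsNClique c s}

/-- The set `S_k` of `k`-simplices of the clique complex of `G`: the cliques with `k + 1`
vertices. -/
abbrev Simplex {n : ℕ} (G : SimpleGraph (Fin n)) (k : ℕ) : Type := CliqueOfCard G (k + 1)

noncomputable instance instFintypeCliqueOfCard {n : ℕ} (G : SimpleGraph (Fin n)) (c : ℕ) :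
    Fintype (CliqueOfCard G c) := Fintype.ofFinite _

/-- The matrix of the boundary map `∂_k : R S_k → R S_{k-1}`. The simplex
`{x_{i_0}, …, x_{i_k}}` with `i_0 < ⋯ < i_k` is sent to the sum over `j` of
`(-1)^(j+1)` times the face without `x_{i_j}`; here `j` is the number of vertices of the
simplex below the removed one. (`S_{k-1}` consists of the cliques with `k` vertices.) -/
def boundary (R : Type) [Ring R] {n : ℕ} (G : SimpleGraph (Fin n)) (k : ℕ) :
    Matrix (CliqueOfCard G k) (Simplex G k) R :=
  fun τ σ => ∑ v ∈ σ.1, if σ.1.erase v = τ.1 then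
    (-1 : R) ^ ((σ.1.filter (fun u => u < v)).card + 1) else 0

/-- The `k`-th Betti number `dim (ker ∂_k / im ∂_{k+1})` over `ℂ`. -/
noncomputable def bettiNumber {n : ℕ} (G : SimpleGraph (Fin n)) (k : ℕ) : ℕ :=
  Module.finrank ℂ
    (LinearMap.ker (boundary ℂ G k).mulVecLin ⧸
      (LinearMap.range (boundary ℂ G (k + 1)).mulVecLin).submoduleOf
        (LinearMap.ker (boundary ℂ G k).mulVecLin))

/-- The normalised Betti number `β_k / |S_k|`. -/
noncomputable def normalisedBetti {n : ℕ} (G : SimpleGraph (Fin n)) (k : ℕ) : ℝ :=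
  (bettiNumber G k : ℝ) / Fintype.card (Simplex G k)

/-- The combinatorial Laplacian `Δ_k = ∂_k† ∂_k + ∂_{k+1} ∂_{k+1}†` (its entries are
real). -/
noncomputable def laplacian {n : ℕ} (G : SimpleGraph (Fin n)) (k : ℕ) :
    Matrix (Simplex G k) (Simplex G k) ℝ :=
  (boundary ℝ G k)ᵀ * boundary ℝ G k + boundary ℝ G (k + 1) * (boundary ℝ G (k + 1))ᵀ

/-- The normalised Laplacian `Δ_k / n`. -/
noncomputable def normLaplacian {n : ℕ} (G : SimpleGraph (Fin n)) (k : ℕ) :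
    Matrix (Simplex G k) (Simplex G k) ℝ :=
  (1 / (n : ℝ)) • laplacian G k

/-- The reflected normalised Laplacian `H = I - Δ_k / n`. -/
noncomputable def reflLaplacian {n : ℕ} (G : SimpleGraph (Fin n)) (k : ℕ) :
    Matrix (Simplex G k) (Simplex G k) ℝ :=
  1 - normLaplacian G k

/-- `δ` is a positive lower bound for the positive eigenvalues of `Δ_k / n`. -/
def IsGapBound {n : ℕ} (G : SimpleGraph (Fin n)) (k : ℕ) (δ : ℝ) : Prop :=
  0 < δ ∧ ∀ μ : ℝ, Module.End.HasEigenvalue (normLaplacian G k).mulVecLin μ → 0 < μ → δ ≤ μ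

/-- The matrix norm `‖M‖₁`: the largest absolute column sum. -/
noncomputable def oneNorm {ι : Type} [Fintype ι] (M : Matrix ι ι ℝ) : ℝ :=
  ⨆ j, ∑ i, |M i j|

/-! ### Randomised algorithms with counted queries to the rows of a matrix -/

/-- Randomised programs that access a matrix with index set `ι` through an oracle only. A program
stops with a value, asks for a row (returned as the dictionary of its nonzero entries), asks
for a random row index, or draws an index from a distribution that it has computed. -/
inductive QueryProg (ι : Type) (α : Type) : Type
  | ret : α → QueryProg ι α
  | sparseRow : ι → ((ι →₀ ℝ) → QueryProg ι α) → QueryProg ι α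
  | randomRowIndex : (ι → QueryProg ι α) → QueryProg ι α
  | draw : PMF ι → (ι → QueryProg ι α) → QueryProg ι α

namespace QueryProg

/-- Sequential composition. -/
def andThen {ι α β : Type} : QueryProg ι α → (α → QueryProg ι β) → QueryProg ι β
  | ret a, f => f a
  | sparseRow i g, f => sparseRow i fun r => (g r).andThen f
  | randomRowIndex g, f => randomRowIndex fun i => (g i).andThen f
  | draw p g, f => draw p fun i => (g i).andThen f

instance instMonad (ι : Type) : Monad (QueryProg ι) where
  pure := ret
  bind := andThen

/-- The joint law of the returned value and of the number of `sparseRow` queries, when the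
program is run on the matrix `M` and row indices are sampled uniformly. -/
noncomputable def run {ι α : Type} [Fintype ι] [Nonempty ι] (M : Matrix ι ι ℝ) :
    QueryProg ι α → PMF (α × ℕ)
  | ret a => PMF.pure (a, 0)
  | sparseRow i g =>
      ((g (Finsupp.equivFunOnFinite.symm (M i))).run M).map fun r => (r.1, r.2 + 1)
  | randomRowIndex g => (PMF.uniformOfFintype ι).bind fun i => (g i).run M
  | draw p g => p.bind fun i => (g i).run M

/-- On the matrix `M`, the probability that the output is at distance `ε` or more from `β` is at
most `η`. -/
def Estimates {ι : Type} [Fintype ι] [Nonempty ι] (A : QueryProg ι ℝ) (M : Matrix ι ι ℝ)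
    (β ε η : ℝ) : Prop :=
  (A.run M).toOuterMeasure {r | ε ≤ |r.1 - β|} ≤ ENNReal.ofReal η

/-- On the matrix `M`, every run of the program makes at most `S` `sparseRow` queries. -/
def QueriesAtMost {ι : Type} [Fintype ι] [Nonempty ι] (A : QueryProg ι ℝ) (M : Matrix ι ι ℝ)
    (S : ℝ) : Prop :=
  ∀ r ∈ (A.run M).support, (r.2 : ℝ) ≤ S

end QueryProg

/-! ### Markov chain trace estimation -/

/-- The `1`-norm of a row. -/
noncomputable def rowNorm {ι : Type} [Fintype ι] (r : ι →₀ ℝ) : ℝ := ∑ j, |r j|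

theorem rowNorm_sum_eq_one {ι : Type} [Fintype ι] (r : ι →₀ ℝ) (h : rowNorm r ≠ 0) :
    ∑ j, ENNReal.ofReal (|r j| / rowNorm r) = 1 := by
  have h0 : 0 ≤ rowNorm r := Finset.sum_nonneg fun j _ => abs_nonneg _
  rw [← ENNReal.ofReal_sum_of_nonneg fun j _ => div_nonneg (abs_nonneg _) h0,
    ← Finset.sum_div]
  change ENNReal.ofReal (rowNorm r / rowNorm r) = 1
  rw [div_self h, ENNReal.ofReal_one]

open Classical in
/-- One step of the Markov chain from the index `i` with row `r`: `j` is chosen with probability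
`|r j| / ‖r‖₁`. If the row vanishes the chain stays at `i` (the weight of the walk is then
`0`, whatever the choice). -/
noncomputable def markovStep {ι : Type} [Fintype ι] (i : ι) (r : ι →₀ ℝ) : PMF ι :=
  if h : rowNorm r ≠ 0 then
    PMF.ofFintype (fun j => ENNReal.ofReal (|r j| / rowNorm r)) (rowNorm_sum_eq_one r h)
  else PMF.pure i

open Classical in
/-- `d` steps of the Markov chain from the current index `i` with current weight `w`; the result
is the final weight if the chain ends at `i₀`, and `0` otherwise. -/
noncomputable def walk {ι : Type} [Fintype ι] (i₀ : ι) : ℕ → ι → ℝ → QueryProg ι ℝ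
  | 0, i, w => .ret (if i = i₀ then w else 0)
  | d + 1, i, w =>
      .sparseRow i fun r =>
        .draw (markovStep i r) fun j => walk i₀ d j (w * (Real.sign (r j) * rowNorm r))

/-- One sample of the random variable `Y_d`. -/
noncomputable def sampleTrace {ι : Type} [Fintype ι] (d : ℕ) : QueryProg ι ℝ :=
  .randomRowIndex fun i => walk i d i 1

/-- The sum of `q` independent samples of `Y_d`. -/
noncomputable def sampleSum {ι : Type} [Fintype ι] (d : ℕ) : ℕ → QueryProg ι ℝ
  | 0 => pure 0
  | q + 1 => do
      let t ← sampleSum d q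
      let s ← sampleTrace d
      pure (t + s)

/-- The estimate of the normalised trace of the `d`-th power from `q` samples (the value is `0`
if `q = 0`). -/
noncomputable def estimateSparseTrace {ι : Type} [Fintype ι] (d q : ℕ) : QueryProg ι ℝ := do
  let t ← sampleSum d q
  pure (t / q)

/-- The number of samples of a random variable with values in `[-R, R]` that are taken in order to
estimate its mean to accuracy `ε` with failure probability `η`. -/
noncomputable def shots (R ε η : ℝ) : ℕ := ⌈(2 * R) ^ 2 * Real.log (2 / η) / (2 * ε ^ 2)⌉₊

/-! ### The algorithm CBNE-Power -/

/-- The power of `H` used by CBNE-Power. -/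
noncomputable def powerDegree (δ ε : ℝ) : ℕ := ⌈Real.log (2 / ε) / δ⌉₊

/-- CBNE-Power, where `R` is the bound on `|Y_d|` from which the number of samples is
computed. -/
noncomputable def cbnePower {ι : Type} [Fintype ι] (δ ε η R : ℝ) : QueryProg ι ℝ :=
  estimateSparseTrace (powerDegree δ ε) (shots R (ε / 2) η)

/-! ### The algorithm CBNE-Chebyshev -/

/-- The degree of the polynomial used by CBNE-Chebyshev. -/
noncomputable def chebDegree (δ ε : ℝ) : ℕ := ⌈Real.log (4 / ε) / √δ⌉₊

/-- The polynomial `p(x) = T_d(x / (1 - δ)) / T_d(1 / (1 - δ))` with `d = chebDegree δ ε`. -/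
noncomputable def chebPoly (δ ε : ℝ) : Polynomial ℝ :=
  Polynomial.C (1 / (Polynomial.Chebyshev.T ℝ (chebDegree δ ε)).eval (1 / (1 - δ))) *
    (Polynomial.Chebyshev.T ℝ (chebDegree δ ε)).comp
      (Polynomial.C (1 / (1 - δ)) * Polynomial.X)

/-- The `2`-norm of the vector of coefficients of a polynomial. -/
noncomputable def coeffNorm (p : Polynomial ℝ) : ℝ := √(∑ i ∈ p.support, p.coeff i ^ 2)

/-- The failure probability `η' = 1 - (1 - η)^(1 / ⌈d/2⌉)` allowed to each trace estimation. -/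
noncomputable def chebEta (δ ε η : ℝ) : ℝ :=
  1 - (1 - η) ^ (1 / (⌈(chebDegree δ ε : ℝ) / 2⌉₊ : ℝ))

/-- The accuracy `ε_i = ε / (2 ⌈d/2⌉ |a_i|)` asked for the trace of the `i`-th power. -/
noncomputable def chebEps (δ ε : ℝ) (i : ℕ) : ℝ :=
  ε / (2 * (⌈(chebDegree δ ε : ℝ) / 2⌉₊ : ℝ) * |(chebPoly δ ε).coeff i|)

open Classical in
/-- The number of samples for the trace of the `i`-th power; none is taken if `a_i = 0`. -/
noncomputable def chebShots (δ ε η : ℝ) (R : ℕ → ℝ) (i : ℕ) : ℕ :=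
  if (chebPoly δ ε).coeff i = 0 then 0 else shots (R i) (chebEps δ ε i) (chebEta δ ε η)

/-- The program that returns `a_0 + a_1 μ_1 + ⋯ + a_m μ_m`, where `μ_i` is an independent
estimate of the normalised trace of the `i`-th power from `q i` samples. -/
noncomputable def polyEstimate {ι : Type} [Fintype ι] (a : ℕ → ℝ) (q : ℕ → ℕ) :
    ℕ → QueryProg ι ℝ
  | 0 => pure (a 0)
  | m + 1 => do
      let s ← polyEstimate a q m
      let μ ← estimateSparseTrace (m + 1) (q (m + 1))
      pure (s + a (m + 1) * μ)

/-- CBNE-Chebyshev, where `R i` is the bound on `|Y_i|` from which the number of samples for the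
`i`-th power is computed. -/
noncomputable def cbneChebyshev {ι : Type} [Fintype ι] (δ ε η : ℝ) (R : ℕ → ℝ) :
    QueryProg ι ℝ :=
  polyEstimate (fun i => (chebPoly δ ε).coeff i) (chebShots δ ε η R) (chebDegree δ ε)

/-! Spectral side. By Hodge theory over ℂ, β_k is the multiplicity of the eigenvalue 0 of Δ_k/n,
that is, of the eigenvalue 1 of H; all other eigenvalues of H lie in [0, 1 - δ]. So if f(1) = 1 and
|f| ≤ e on [0, 1 - δ], the normalised trace of f(H) is within e of β_k/|S_k|
(`abs_trace_sub_normalisedBetti_le`). For f = x^d, (1 - δ)^d ≤ exp(-δd) ≤ ε/2. For f = p, the bound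
is 1/T_d(1/(1 - δ)), and cosh √δ ≤ 1/(1 - δ) together with T_d(cosh t) = cosh(dt) makes a degree of
order log(4/ε)/√δ sufficient.

Both H ≥ 0 and ‖H‖₁ ≤ 2 come from comparison with the full simplex, whose Laplacian is n times the
identity: the signed operators that remove one vertex satisfy the canonical anticommutation
relations. Passing to the clique complex loses only the cofaces that are not cliques, so nH is a
Gram matrix indexed by the non-cliques (`smul_one_sub_laplacian_apply`). A simplex has at most n
cofaces, and a non-clique has at most two clique facets because one of its missing edges must be
broken.

Statistical side. The Markov chain is importance sampling of the paths in the expansion of tr H^i: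
Y_i has mean tr H^i/|S_k| and |Y_i| ≤ ‖H‖₁^i, so Hoeffding's inequality gives the number of samples.
For Chebyshev the success probabilities of the independent estimates multiply; by parity at most
⌈d/2⌉ estimates occur, and (1 - η')^⌈d/2⌉ = 1 - η. The accuracy ε_i is inversely proportional to
|a_i|, so the sample numbers are proportional to a_i² up to rounding and sum to ‖p‖₂². Query counts
are deterministic, since q samples of Y_i always cost qi queries; what remains is to absorb the
ceilings. -/

/-! ### Expectations of randomised programs -/

namespace QueryProg

variable {ι : Type} [Fintype ι]

/-- The expectation of `f` of the value returned by a program that is run on `M`. -/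
noncomputable def expect {α : Type} (M : Matrix ι ι ℝ) (f : α → ℝ) : QueryProg ι α → ℝ
  | ret a => f a
  | sparseRow i g => (g (Finsupp.equivFunOnFinite.symm (M i))).expect M f
  | randomRowIndex g => ∑ i, (Fintype.card ι : ℝ)⁻¹ * (g i).expect M f
  | draw p g => ∑ i, (p i).toReal * (g i).expect M f

/-- Every value that a program can return on `M` satisfies `P`, whatever the random choices. -/
def Surely {α : Type} (M : Matrix ι ι ℝ) (P : α → Prop) : QueryProg ι α → Prop
  | ret a => P a
  | sparseRow i g => (g (Finsupp.equivFunOnFinite.symm (M i))).Surely M P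
  | randomRowIndex g => ∀ i, (g i).Surely M P
  | draw _ g => ∀ i, (g i).Surely M P

/-- Every run of a program on `M` makes exactly `c` row queries. -/
def Costs {α : Type} (M : Matrix ι ι ℝ) : QueryProg ι α → ℕ → Prop
  | ret _, c => c = 0
  | sparseRow i g, c => ∃ c', c = c' + 1 ∧ (g (Finsupp.equivFunOnFinite.symm (M i))).Costs M c'
  | randomRowIndex g, c => ∀ i, (g i).Costs M c
  | draw _ g, c => ∀ i, (g i).Costs M c

theorem sum_toReal_pmf (p : PMF ι) : ∑ i, (p i).toReal = 1 := by
  rw [← ENNReal.toReal_sum fun i _ => p.apply_ne_top i, ← tsum_fintype (L := .unconditional ι),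
    p.tsum_coe, ENNReal.toReal_one]

section

variable {α β : Type} (M : Matrix ι ι ℝ)

/-- The law of total expectation. It is the form in which independence of successive samples is
used. -/
theorem expect_andThen (f : β → ℝ) (A : QueryProg ι α) (F : α → QueryProg ι β) :
    (A.andThen F).expect M f = A.expect M fun a => (F a).expect M f := by
  induction A with
  | ret a => rfl
  | sparseRow i g ih => exact ih _
  | randomRowIndex g ih => simp only [andThen, expect, ih]
  | draw p g ih => simp only [andThen, expect, ih]

theorem Costs.andThen {A : QueryProg ι α} {F : α → QueryProg ι β} {a b : ℕ}
    (hA : A.Costs M a) (hF : ∀ x, (F x).Costs M b) : (A.andThen F).Costs M (a + b) := by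
  induction A generalizing a with
  | ret x =>
    obtain rfl : a = 0 := hA
    rw [zero_add]
    exact hF x
  | sparseRow i g ih =>
    obtain ⟨c, rfl, hc⟩ := hA
    exact ⟨c + b, by omega, ih _ hc⟩
  | randomRowIndex g ih => exact fun i => ih i (hA i)
  | draw p g ih => exact fun i => ih i (hA i)

theorem expect_add (f g : α → ℝ) (A : QueryProg ι α) :
    (A.expect M fun a => f a + g a) = A.expect M f + A.expect M g := by
  induction A with
  | ret a => rfl
  | sparseRow i g ih => exact ih _
  | randomRowIndex g ih => simp only [expect, ih, mul_add, Finset.sum_add_distrib]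
  | draw p g ih => simp only [expect, ih, mul_add, Finset.sum_add_distrib]

theorem expect_const_mul (c : ℝ) (f : α → ℝ) (A : QueryProg ι α) :
    (A.expect M fun a => c * f a) = c * A.expect M f := by
  induction A with
  | ret a => rfl
  | sparseRow i g ih => exact ih _
  | randomRowIndex g ih => simp only [expect, ih, mul_left_comm _ c, Finset.mul_sum]
  | draw p g ih => simp only [expect, ih, mul_left_comm _ c, Finset.mul_sum]

variable {M} in
theorem Surely.expect_le_expect {P : α → Prop} {f g : α → ℝ} {A : QueryProg ι α}
    (hA : A.Surely M P) (h : ∀ a, P a → f a ≤ g a) : A.expect M f ≤ A.expect M g := by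
  induction A with
  | ret a => exact h a hA
  | sparseRow i g ih => exact ih _ hA
  | randomRowIndex g ih =>
    exact Finset.sum_le_sum fun i _ =>
      mul_le_mul_of_nonneg_left (ih i (hA i)) (by positivity)
  | draw p g ih =>
    exact Finset.sum_le_sum fun i _ =>
      mul_le_mul_of_nonneg_left (ih i (hA i)) ENNReal.toReal_nonneg

theorem surely_true (A : QueryProg ι α) : A.Surely M fun _ => True := by
  induction A with
  | ret a => trivial
  | sparseRow i g ih => exact ih _
  | randomRowIndex g ih => exact ih
  | draw p g ih => exact ih

variable {M} in
theorem Surely.mono {P Q : α → Prop} {A : QueryProg ι α} (hA : A.Surely M P)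
    (h : ∀ a, P a → Q a) : A.Surely M Q := by
  induction A with
  | ret a => exact h a hA
  | sparseRow i g ih => exact ih _ hA
  | randomRowIndex g ih => exact fun i => ih i (hA i)
  | draw p g ih => exact fun i => ih i (hA i)

theorem expect_mono {f g : α → ℝ} (A : QueryProg ι α) (h : ∀ a, f a ≤ g a) :
    A.expect M f ≤ A.expect M g :=
  (surely_true M A).expect_le_expect fun a _ => h a

open Classical in
/-- The probability that the value returned on `M` satisfies `P`. -/
noncomputable def prob (P : α → Prop) (A : QueryProg ι α) : ℝ :=
  A.expect M fun a => if P a then 1 else 0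

theorem prob_mono {P Q : α → Prop} (A : QueryProg ι α) (h : ∀ a, P a → Q a) :
    A.prob M P ≤ A.prob M Q :=
  expect_mono M A fun a => by
    by_cases hP : P a
    · simp [hP, h a hP]
    · simp only [hP, if_false]
      split_ifs <;> norm_num

variable [Nonempty ι]

theorem expect_const (c : ℝ) (A : QueryProg ι α) : (A.expect M fun _ => c) = c := by
  induction A with
  | ret a => rfl
  | sparseRow i g ih => exact ih _
  | randomRowIndex g ih => simp [expect, ih]
  | draw p g ih => simp only [expect, ih, ← Finset.sum_mul, sum_toReal_pmf, one_mul]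

theorem expect_nonneg {f : α → ℝ} (A : QueryProg ι α) (h : ∀ a, 0 ≤ f a) :
    0 ≤ A.expect M f := by
  simpa only [expect_const] using expect_mono M A h

open Classical in
-- Bridge from the joint law of output and query count to the real-valued recursive expectation, in
-- which all estimates are carried out.
theorem toOuterMeasure_run (P : α → Prop) (A : QueryProg ι α) :
    (A.run M).toOuterMeasure {r | P r.1} = ENNReal.ofReal (A.prob M P) := by
  unfold prob
  have key : ∀ B : QueryProg ι α,
      0 ≤ B.expect M fun a => if P a then (1 : ℝ) else 0 := fun B =>
    expect_nonneg M B fun a => by split_ifs <;> norm_num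
  induction A with
  | ret a =>
    rw [run, PMF.toOuterMeasure_pure_apply]
    simp only [Set.mem_ofPred_eq, expect]
    split_ifs <;> simp
  | sparseRow i g ih =>
    rw [run, PMF.toOuterMeasure_map_apply]
    exact ih _
  | randomRowIndex g ih =>
    rw [run, PMF.toOuterMeasure_bind_apply, tsum_fintype, expect,
      ENNReal.ofReal_sum_of_nonneg fun i _ => mul_nonneg (by positivity) (key _)]
    refine Finset.sum_congr rfl fun i _ => ?_
    rw [ih, ENNReal.ofReal_mul (by positivity), PMF.uniformOfFintype_apply,
      ENNReal.ofReal_inv_of_pos (by exact_mod_cast Fintype.card_pos), ENNReal.ofReal_natCast]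
  | draw p g ih =>
    rw [run, PMF.toOuterMeasure_bind_apply, tsum_fintype, expect,
      ENNReal.ofReal_sum_of_nonneg fun i _ => mul_nonneg ENNReal.toReal_nonneg (key _)]
    refine Finset.sum_congr rfl fun i _ => ?_
    rw [ih, ENNReal.ofReal_mul ENNReal.toReal_nonneg, ENNReal.ofReal_toReal (p.apply_ne_top i)]

variable {M} in
theorem Costs.eq_of_mem_support {A : QueryProg ι α} {c : ℕ} (hA : A.Costs M c) :
    ∀ r ∈ (A.run M).support, r.2 = c := by
  induction A generalizing c with
  | ret a =>
    intro r hr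
    rw [run, PMF.mem_support_pure_iff] at hr
    rw [hr]
    exact hA.symm
  | sparseRow i g ih =>
    intro r hr
    rw [run, PMF.mem_support_map_iff] at hr
    obtain ⟨s, hs, rfl⟩ := hr
    obtain ⟨c', rfl, hc⟩ := hA
    rw [ih _ hc s hs]
  | randomRowIndex g ih =>
    intro r hr
    rw [run, PMF.mem_support_bind_iff] at hr
    obtain ⟨i, -, hi⟩ := hr
    exact ih i (hA i) r hi
  | draw p g ih =>
    intro r hr
    rw [run, PMF.mem_support_bind_iff] at hr
    obtain ⟨i, -, hi⟩ := hr
    exact ih i (hA i) r hi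

theorem Costs.queriesAtMost {A : QueryProg ι ℝ} {c : ℕ} {S : ℝ} (hA : A.Costs M c)
    (h : (c : ℝ) ≤ S) : A.QueriesAtMost M S := fun r hr => by
  rwa [hA.eq_of_mem_support r hr]

theorem prob_not (P : α → Prop) (A : QueryProg ι α) :
    A.prob M (fun a => ¬ P a) = 1 - A.prob M P := by
  unfold prob
  rw [eq_sub_iff_add_eq, ← expect_add]
  refine Eq.trans ?_ (expect_const M 1 A)
  congr 1
  funext a
  by_cases hP : P a <;> simp [hP]

variable {M} in
theorem Surely.prob_eq_one {P : α → Prop} {A : QueryProg ι α} (h : A.Surely M P) :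
    A.prob M P = 1 :=
  le_antisymm
    ((expect_mono M A fun a => by split_ifs <;> norm_num).trans_eq (expect_const M 1 A))
    ((expect_const M 1 A).symm.trans_le (h.expect_le_expect fun a ha => by simp [ha]))

theorem prob_nonneg (P : α → Prop) (A : QueryProg ι α) : 0 ≤ A.prob M P :=
  expect_nonneg M A fun a => by split_ifs <;> norm_num

theorem estimates_of_prob {A : QueryProg ι ℝ} {β ε η : ℝ}
    (h : A.prob M (fun x => ε ≤ |x - β|) ≤ η) : A.Estimates M β ε η := by
  rw [Estimates, toOuterMeasure_run M (fun x => ε ≤ |x - β|)]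
  exact ENNReal.ofReal_le_ofReal h

end

end QueryProg

/-! ### Hoeffding's inequality for repeated samples -/

open MeasureTheory ProbabilityTheory in
-- The left side is the moment generating function of the law on {1, -1} with mean m, so this is
-- Hoeffding's lemma for a two-point variable.
theorem cosh_add_mul_sinh_le {m : ℝ} (hm : |m| ≤ 1) (s : ℝ) :
    Real.cosh s + m * Real.sinh s ≤ Real.exp (m * s + s ^ 2 / 2) := by
  obtain ⟨h1, h2⟩ := abs_le.1 hm
  have hp : 0 ≤ (1 + m) / 2 := by linarith
  have hn : 0 ≤ (1 - m) / 2 := by linarith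
  let μ : Measure ℝ := ENNReal.ofReal ((1 + m) / 2) • Measure.dirac 1 +
    ENNReal.ofReal ((1 - m) / 2) • Measure.dirac (-1)
  have hint : ∀ f : ℝ → ℝ, ∫ x, f x ∂μ = (1 + m) / 2 * f 1 + (1 - m) / 2 * f (-1) := by
    intro f
    have hi : ∀ a : ℝ, Integrable f (Measure.dirac a) := fun a => integrable_dirac (by simp)
    rw [integral_add_measure ((hi _).smul_measure (by simp)) ((hi _).smul_measure (by simp)),
      integral_smul_measure, integral_smul_measure, integral_dirac, integral_dirac,
      ENNReal.toReal_ofReal hp, ENNReal.toReal_ofReal hn, smul_eq_mul, smul_eq_mul]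
  have : IsProbabilityMeasure μ := ⟨by
    simp only [μ, Measure.add_apply, Measure.smul_apply, measure_univ, smul_eq_mul, mul_one]
    rw [← ENNReal.ofReal_add hp hn]
    ring_nf
    simp⟩
  have hmem : ∀ᵐ x ∂μ, id x ∈ Set.Icc (-1 : ℝ) 1 := by
    rw [ae_add_measure_iff]
    constructor <;> refine Measure.ae_smul_measure ?_ _ <;>
      refine (ae_dirac_iff (p := fun x : ℝ => x ∈ Set.Icc (-1 : ℝ) 1) measurableSet_Icc).2 ?_ <;>
      norm_num
  have h := (hasSubgaussianMGF_of_mem_Icc (μ := μ) (X := id) aemeasurable_id hmem).mgf_le s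
  rw [mgf, hint, hint] at h
  -- The variance proxy is the square of half the length of [-1, 1].
  have hc : (((‖(1 : ℝ) - -1‖₊ / 2) ^ 2 : NNReal) : ℝ) = 1 := by
    rw [NNReal.coe_pow, NNReal.coe_div, coe_nnnorm, Real.norm_eq_abs]
    norm_num
  rw [hc] at h
  have hmean : (1 + m) / 2 * id 1 + (1 - m) / 2 * id (-1) = m := by
    simp only [id]
    ring
  rw [hmean] at h
  simp only [id] at h
  have e1 : Real.exp (s * (1 - m)) = Real.exp s * Real.exp (-(m * s)) := by
    rw [← Real.exp_add]; ring_nf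
  have e2 : Real.exp (s * (-1 - m)) = Real.exp (-s) * Real.exp (-(m * s)) := by
    rw [← Real.exp_add]; ring_nf
  rw [e1, e2] at h
  have e3 : Real.exp (m * s) * Real.exp (-(m * s)) = 1 := by
    rw [← Real.exp_add]; simp
  -- `h` bounds the centred variable; multiplying by exp(ms) undoes the centring.
  calc Real.cosh s + m * Real.sinh s
      = Real.exp (m * s) * ((1 + m) / 2 * (Real.exp s * Real.exp (-(m * s))) +
          (1 - m) / 2 * (Real.exp (-s) * Real.exp (-(m * s)))) := by
        rw [Real.cosh_eq, Real.sinh_eq]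
        linear_combination (-((1 + m) / 2 * Real.exp s + (1 - m) / 2 * Real.exp (-s))) * e3
    _ ≤ Real.exp (m * s) * Real.exp (1 * s ^ 2 / 2) :=
        mul_le_mul_of_nonneg_left h (Real.exp_pos _).le
    _ = Real.exp (m * s + s ^ 2 / 2) := by rw [one_mul, Real.exp_add]

/-- By convexity the exponential lies below its chord over [-tR, tR]; the right side is that chord
at ty. -/
theorem exp_mul_le_cosh_add_sinh {R y : ℝ} (hR : 0 < R) (hy : |y| ≤ R) (t : ℝ) :
    Real.exp (t * y) ≤ Real.cosh (t * R) + y / R * Real.sinh (t * R) := by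
  obtain ⟨h1, h2⟩ := abs_le.1 hy
  have hconv : ConvexOn ℝ Set.univ Real.exp := convexOn_exp
  have h := hconv.2 (Set.mem_univ (t * R)) (Set.mem_univ (-(t * R)))
    (div_nonneg (by linarith) (by linarith) : 0 ≤ (R + y) / (2 * R))
    (div_nonneg (by linarith) (by linarith) : 0 ≤ (R - y) / (2 * R))
    (by field_simp; ring)
  have e : ((R + y) / (2 * R)) • (t * R) + ((R - y) / (2 * R)) • (-(t * R)) = t * y := by
    simp only [smul_eq_mul]
    field_simp
    ring
  rw [e] at h
  refine h.trans_eq ?_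
  rw [Real.cosh_eq, Real.sinh_eq]
  simp only [smul_eq_mul]
  field_simp
  ring

namespace QueryProg

variable {ι : Type} [Fintype ι] (M : Matrix ι ι ℝ)

/-- Hoeffding's lemma for a program whose values lie in `[-R, R]`. -/
theorem expect_exp_le [Nonempty ι] {A : QueryProg ι ℝ} {R : ℝ} (hR : 0 < R)
    (hA : A.Surely M fun y => |y| ≤ R) (t : ℝ) :
    (A.expect M fun y => Real.exp (t * y)) ≤
      Real.exp (t * A.expect M (fun y => y) + t ^ 2 * R ^ 2 / 2) := by
  have hm : |A.expect M (fun y => y)| ≤ R := by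
    rw [abs_le]
    constructor
    · have := hA.expect_le_expect (f := fun _ => -R) (g := fun y => y) fun y hy => (abs_le.1 hy).1
      rwa [expect_const] at this
    · have := hA.expect_le_expect (f := fun y => y) (g := fun _ => R) fun y hy => (abs_le.1 hy).2
      rwa [expect_const] at this
  -- The chord is affine in y, so its expectation depends on the mean only. This reduces the claim
  -- to the two-point law with mean E[y]/R.
  have h := hA.expect_le_expect (f := fun y => Real.exp (t * y))
    (g := fun y => Real.cosh (t * R) + (Real.sinh (t * R) / R) * y) fun y hy =>
      (exp_mul_le_cosh_add_sinh hR hy t).trans_eq (by ring)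
  rw [expect_add, expect_const, expect_const_mul] at h
  refine h.trans ?_
  have h2 := cosh_add_mul_sinh_le (m := A.expect M (fun y => y) / R)
    (by rw [abs_div, abs_of_pos hR]; exact (div_le_one hR).2 hm) (t * R)
  calc _ = Real.cosh (t * R) + A.expect M (fun y => y) / R * Real.sinh (t * R) := by ring
    _ ≤ _ := h2
    _ = _ := by
      congr 1
      field_simp

/-- Independence: the moment generating function of a sum of independent samples is a product. -/
theorem expect_exp_sampleSum (d : ℕ) (t : ℝ) (q : ℕ) :
    ((sampleSum d q).expect M fun y => Real.exp (t * y)) =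
      ((sampleTrace d).expect M fun y => Real.exp (t * y)) ^ q := by
  induction q with
  | zero =>
    change Real.exp (t * 0) = _
    simp
  | succ q ih =>
    change ((sampleSum d q).andThen fun a =>
      (sampleTrace d).andThen fun b => ret (a + b)).expect M _ = _
    rw [expect_andThen]
    simp only [expect_andThen, expect, mul_add, Real.exp_add, expect_const_mul]
    rw [pow_succ, ← ih, mul_comm, ← expect_const_mul]
    simp only [mul_comm]

theorem prob_estimateSparseTrace_le [Nonempty ι] {d q : ℕ} (hq : 0 < q) {R ε : ℝ} (hR : 0 < R)
    (hε : 0 ≤ ε) (hA : (sampleTrace d).Surely M fun y => |y| ≤ R) :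
    (estimateSparseTrace d q).prob M
        (fun x => ε ≤ |x - (sampleTrace d).expect M fun y => y|) ≤
      2 * Real.exp (-(q * ε ^ 2 / (2 * R ^ 2))) := by
  set μ := (sampleTrace d).expect M fun y => y with hμ
  have hq' : (0 : ℝ) < q := by exact_mod_cast hq
  -- The minimiser of the Chernoff exponent -tε + t²R²/2; its value there is -ε²/(2R²).
  set t := ε / R ^ 2 with ht
  have ht0 : 0 ≤ t := by positivity
  have hb : ∀ s : ℝ, ((sampleSum d q).expect M fun y => Real.exp (s * y)) ≤
      Real.exp (q * (s * μ + s ^ 2 * R ^ 2 / 2)) := fun s => by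
    rw [expect_exp_sampleSum, Real.exp_nat_mul]
    exact pow_le_pow_left₀ (expect_nonneg M _ fun _ => (Real.exp_pos _).le)
      (expect_exp_le M hR hA s) q
  change ((sampleSum d q).andThen fun x => ret (x / q)).expect M _ ≤ _
  rw [expect_andThen]
  simp only [expect]
  -- Both tails at once: the indicator of a deviation is at most the sum of the exponential weights
  -- for the upper and the lower tail.
  have h1 : ((sampleSum d q).expect M fun x => if ε ≤ |x / q - μ| then (1 : ℝ) else 0) ≤
      (sampleSum d q).expect M fun x =>
        Real.exp (-(q * (t * ε + t * μ))) * Real.exp (t * x) +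
        Real.exp (-(q * (t * ε - t * μ))) * Real.exp (-t * x) := by
    refine expect_mono M _ fun x => ?_
    rw [← Real.exp_add, ← Real.exp_add]
    split_ifs with h
    · have hx : x = q * (x / q) := by field_simp
      rcases le_abs.1 h with h | h
      · have : 1 ≤ Real.exp (-(q * (t * ε + t * μ)) + t * x) := by
          rw [Real.one_le_exp_iff, hx]
          have : 0 ≤ q * (t * (x / q - μ - ε)) :=
            mul_nonneg hq'.le (mul_nonneg ht0 (by linarith))
          linarith
        linarith [Real.exp_pos (-(q * (t * ε - t * μ)) + -t * x)]
      · have : 1 ≤ Real.exp (-(q * (t * ε - t * μ)) + -t * x) := by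
          rw [Real.one_le_exp_iff, hx]
          have : 0 ≤ q * (t * (-(x / q - μ) - ε)) :=
            mul_nonneg hq'.le (mul_nonneg ht0 (by linarith))
          linarith
        linarith [Real.exp_pos (-(q * (t * ε + t * μ)) + t * x)]
    · positivity
  refine le_trans (le_of_eq ?_) (h1.trans ?_)
  · rfl
  rw [expect_add, expect_const_mul, expect_const_mul, two_mul]
  have hexp : t * ε - t ^ 2 * R ^ 2 / 2 = ε ^ 2 / (2 * R ^ 2) := by
    rw [ht]
    field_simp
    ring
  refine add_le_add ?_ ?_
  · refine (mul_le_mul_of_nonneg_left (hb t) (Real.exp_pos _).le).trans_eq ?_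
    rw [← Real.exp_add]
    congr 1
    linear_combination -(q : ℝ) * hexp
  · refine (mul_le_mul_of_nonneg_left (hb (-t)) (Real.exp_pos _).le).trans_eq ?_
    rw [← Real.exp_add]
    congr 1
    linear_combination -(q : ℝ) * hexp

theorem prob_estimateSparseTrace_shots_le [Nonempty ι] {d : ℕ} {R ε η : ℝ} (hR : 0 ≤ R)
    (hε : 0 < ε) (hη : 0 < η) (hη1 : η < 1)
    (hA : (sampleTrace d).Surely M fun y => |y| ≤ R) :
    (estimateSparseTrace d (shots R ε η)).prob M
        (fun x => ε ≤ |x - (sampleTrace d).expect M fun y => y|) ≤ η := by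
  have hlog : 0 < Real.log (2 / η) := Real.log_pos (by rw [lt_div_iff₀ hη]; linarith)
  -- For R = 0 no sample is taken and the estimate is 0/0 = 0, which is the exact mean.
  rcases hR.eq_or_lt with rfl | hR
  · have hμ : ((sampleTrace d).expect M fun y => y) = 0 := by
      refine le_antisymm ?_ ?_
      · have := hA.expect_le_expect (f := fun y => y) (g := fun _ => 0)
          fun y hy => (abs_le.1 hy).2
        rwa [expect_const] at this
      · have := hA.expect_le_expect (f := fun _ => 0) (g := fun y => y)
          fun y hy => by simpa using (abs_le.1 hy).1
        rwa [expect_const] at this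
    have hs : shots 0 ε η = 0 := by simp [shots]
    rw [hs, hμ]
    change (if ε ≤ |(0 : ℝ) / ((0 : ℕ) : ℝ) - 0| then (1 : ℝ) else 0) ≤ η
    simp [hε.not_ge, hη.le]
  · have hq : 0 < shots R ε η := Nat.ceil_pos.2 (by positivity)
    refine (prob_estimateSparseTrace_le M hq hR hε.le hA).trans ?_
    have h1 : Real.log (2 / η) ≤ shots R ε η * ε ^ 2 / (2 * R ^ 2) := by
      have := Nat.le_ceil ((2 * R) ^ 2 * Real.log (2 / η) / (2 * ε ^ 2))
      rw [le_div_iff₀ (by positivity)]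
      rw [div_le_iff₀ (by positivity)] at this
      unfold shots
      linarith
    calc 2 * Real.exp (-(shots R ε η * ε ^ 2 / (2 * R ^ 2)))
        ≤ 2 * Real.exp (-Real.log (2 / η)) := by gcongr
      _ = η := by
        rw [Real.exp_neg, Real.exp_log (by positivity)]
        field_simp

end QueryProg

/-! ### The Markov chain -/

section Walk

variable {ι : Type} [Fintype ι] (M : Matrix ι ι ℝ)

open QueryProg

/-- Importance sampling: the transition probability |r_j|/‖r‖₁ times the weight sign(r_j)‖r‖₁ is
r_j. For a zero row both sides vanish, whatever the chain does. -/
theorem sum_markovStep (i : ι) (r : ι →₀ ℝ) (f : ι → ℝ) :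
    ∑ j, (markovStep i r j).toReal * (Real.sign (r j) * rowNorm r * f j) = ∑ j, r j * f j := by
  refine Finset.sum_congr rfl fun j _ => ?_
  have hs : Real.sign (r j) * |r j| = r j := by
    rcases lt_trichotomy (r j) 0 with h | h | h
    · rw [Real.sign_of_neg h, abs_of_neg h]
      ring
    · rw [h, abs_zero, mul_zero]
    · rw [Real.sign_of_pos h, abs_of_pos h, one_mul]
  rw [markovStep]
  split_ifs with h
  · have h0 : 0 ≤ rowNorm r := Finset.sum_nonneg fun j _ => abs_nonneg _
    rw [PMF.ofFintype_apply, ENNReal.toReal_ofReal (div_nonneg (abs_nonneg _) h0)]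
    calc _ = (Real.sign (r j) * |r j|) * f j * (rowNorm r / rowNorm r) := by ring
      _ = _ := by rw [hs, div_self h, mul_one]
  · have h0 : r j = 0 := by
      have := (Finset.sum_eq_zero_iff_of_nonneg fun j _ => abs_nonneg (r j)).1
        (not_not.1 h) j (Finset.mem_univ j)
      exact abs_eq_zero.1 this
    simp [h0]

/-- Averaging over the first step multiplies by one factor of M, so the walk is an unbiased estimate
of an entry of the power. -/
theorem expect_walk [DecidableEq ι] (i₀ : ι) (d : ℕ) (i : ι) (w : ℝ) :
    ((walk i₀ d i w).expect M fun y => y) = w * (M ^ d) i i₀ := by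
  induction d generalizing i w with
  | zero => simp [walk, expect, Matrix.one_apply]
  | succ d ih =>
    simp only [walk, expect, ih]
    have := sum_markovStep i (Finsupp.equivFunOnFinite.symm (M i))
      (fun j => w * (M ^ d) j i₀)
    rw [pow_succ', Matrix.mul_apply, Finset.mul_sum]
    refine (Finset.sum_congr rfl fun j _ => ?_).trans
      (this.trans (Finset.sum_congr rfl fun j _ => ?_))
    · ring
    · simp only [Finsupp.equivFunOnFinite_symm_apply_apply]
      ring

theorem expect_sampleTrace [DecidableEq ι] (d : ℕ) :
    ((sampleTrace d).expect M fun y => y) = (M ^ d).trace / Fintype.card ι := by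
  simp only [sampleTrace, expect, expect_walk, one_mul, Matrix.trace, Matrix.diag,
    ← Finset.mul_sum]
  rw [div_eq_inv_mul]

/-- Each step multiplies the weight by at most one row norm. The bound holds for every choice of
path, even one of probability zero. -/
theorem surely_walk {B : ℝ} (hB : 0 ≤ B) (hM : ∀ i, ∑ j, |M i j| ≤ B) (i₀ : ι) (d : ℕ) (i : ι)
    (w : ℝ) : (walk i₀ d i w).Surely M fun y => |y| ≤ |w| * B ^ d := by
  induction d generalizing i w with
  | zero =>
    simp only [walk, Surely]
    split_ifs <;> simp
  | succ d ih =>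
    simp only [walk, Surely]
    intro j
    refine (ih j _).mono fun y hy => hy.trans ?_
    set r := Finsupp.equivFunOnFinite.symm (M i)
    have h0 : 0 ≤ rowNorm r := Finset.sum_nonneg fun j _ => abs_nonneg _
    have h1 : |Real.sign (r j)| ≤ 1 := by
      rcases Real.sign_apply_eq (r j) with h | h | h <;> simp [h]
    have h2 : rowNorm r ≤ B := hM i
    calc |w * (Real.sign (r j) * rowNorm r)| * B ^ d
        = |w| * (|Real.sign (r j)| * rowNorm r) * B ^ d := by
          rw [abs_mul, abs_mul, abs_of_nonneg h0]
      _ ≤ |w| * (1 * B) * B ^ d := by gcongr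
      _ = |w| * B ^ (d + 1) := by ring

theorem surely_sampleTrace {B : ℝ} (hB : 0 ≤ B) (hM : ∀ i, ∑ j, |M i j| ≤ B) (d : ℕ) :
    (sampleTrace d).Surely M fun y => |y| ≤ B ^ d := fun i => by
  simpa using surely_walk M hB hM i d i 1

theorem costs_walk (i₀ : ι) (d : ℕ) (i : ι) (w : ℝ) : (walk i₀ d i w).Costs M d := by
  induction d generalizing i w with
  | zero => exact rfl
  | succ d ih => exact ⟨d, rfl, fun j => ih _ _⟩

theorem costs_sampleSum (d q : ℕ) :
    (sampleSum d q : QueryProg ι ℝ).Costs M (q * d) := by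
  induction q with
  | zero =>
    rw [zero_mul]
    exact rfl
  | succ q ih =>
    rw [Nat.succ_mul]
    exact ih.andThen M fun t => Costs.andThen M (a := d) (b := 0)
      (fun i => costs_walk M i d i 1) fun s => rfl

theorem costs_estimateSparseTrace (d q : ℕ) :
    (estimateSparseTrace d q : QueryProg ι ℝ).Costs M (q * d) :=
  (costs_sampleSum M d q).andThen M (b := 0) fun _ => rfl

theorem costs_polyEstimate (a : ℕ → ℝ) (q : ℕ → ℕ) (m : ℕ) :
    (polyEstimate a q m : QueryProg ι ℝ).Costs M (∑ i ∈ Finset.Icc 1 m, q i * i) := by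
  induction m with
  | zero => exact rfl
  | succ m ih =>
    rw [Finset.sum_Icc_succ_top (by omega)]
    exact ih.andThen M fun s => (costs_estimateSparseTrace M (m + 1) (q (m + 1))).andThen M
      (b := 0) fun _ => rfl

open Classical in
/-- If every trace is estimated to accuracy `e / |a i|` with failure probability at most `η`,
then the polynomial is estimated to accuracy `e` times the number of traces, and the success
probabilities multiply. -/
theorem prob_polyEstimate_ge [Nonempty ι] {a : ℕ → ℝ} {q : ℕ → ℕ} {μ : ℕ → ℝ} {e η : ℝ} (hη : η ≤ 1)
    (h : ∀ i, 1 ≤ i → a i ≠ 0 →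
      (estimateSparseTrace i (q i)).prob M (fun x => e / |a i| ≤ |x - μ i|) ≤ η) (m : ℕ) :
    (1 - η) ^ ((Finset.Icc 1 m).filter fun i => a i ≠ 0).card ≤
      (polyEstimate a q m).prob M fun x =>
        |x - (a 0 + ∑ i ∈ Finset.Icc 1 m, a i * μ i)| ≤
          ((Finset.Icc 1 m).filter fun i => a i ≠ 0).card * e := by
  induction m with
  | zero =>
    refine le_of_eq ?_
    simp only [Finset.Icc_eq_empty_of_lt zero_lt_one, Finset.filter_empty, Finset.card_empty,
      pow_zero, Finset.sum_empty, Nat.cast_zero, zero_mul, add_zero]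
    change 1 = if |a 0 - a 0| ≤ 0 then (1 : ℝ) else 0
    simp
  | succ m ih =>
    have hIcc : Finset.Icc 1 (m + 1) = insert (m + 1) (Finset.Icc 1 m) := by
      ext i
      simp only [Finset.mem_Icc, Finset.mem_insert]
      omega
    have hnot : m + 1 ∉ (Finset.Icc 1 m).filter fun i => a i ≠ 0 := by simp
    set N := ((Finset.Icc 1 m).filter fun i => a i ≠ 0).card with hN
    set s := a 0 + ∑ i ∈ Finset.Icc 1 m, a i * μ i with hs
    have hs' : a 0 + ∑ i ∈ Finset.Icc 1 (m + 1), a i * μ i = s + a (m + 1) * μ (m + 1) := by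
      rw [Finset.sum_Icc_succ_top (by omega), hs, add_assoc]
    rw [hs']
    have hprog : ∀ P : ℝ → Prop, (polyEstimate a q (m + 1)).prob M P =
        (polyEstimate a q m).expect M fun x =>
          (estimateSparseTrace (m + 1) (q (m + 1))).prob M fun y => P (x + a (m + 1) * y) := by
      intro P
      change ((polyEstimate a q m).andThen fun x =>
        (estimateSparseTrace (m + 1) (q (m + 1))).andThen fun y =>
          ret (x + a (m + 1) * y)).expect M _ = _
      rw [expect_andThen]
      simp only [expect_andThen]
      rfl
    rw [hprog]
    -- A vanishing coefficient cancels whatever the estimate returns, so this stage costs neither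
    -- accuracy nor probability.
    by_cases ha : a (m + 1) = 0
    · have hc : ((Finset.Icc 1 (m + 1)).filter fun i => a i ≠ 0).card = N := by
        rw [hIcc, Finset.filter_insert, if_neg (not_not.2 ha)]
      rw [hc]
      refine ih.trans (expect_mono M _ fun x => ?_)
      split_ifs with hx
      · refine ((surely_true M _).mono fun y _ => ?_).prob_eq_one.symm.le
        simpa [ha] using hx
      · exact prob_nonneg M _ _
    · have hc : ((Finset.Icc 1 (m + 1)).filter fun i => a i ≠ 0).card = N + 1 := by
        rw [hIcc, Finset.filter_insert, if_pos ha, Finset.card_insert_of_notMem hnot]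
      rw [hc, pow_succ']
      refine (mul_le_mul_of_nonneg_left ih (by linarith)).trans ?_
      unfold prob
      rw [← expect_const_mul]
      refine expect_mono M _ fun x => ?_
      -- If the partial sum is good, the fresh estimate succeeds with probability at least 1 - η
      -- independently of it; otherwise the left side is 0.
      split_ifs with hx
      · have h1 := h (m + 1) (by omega) ha
        have h2 := prob_not M (fun y => e / |a (m + 1)| ≤ |y - μ (m + 1)|)
          (estimateSparseTrace (m + 1) (q (m + 1)))
        rw [mul_one]
        refine (by linarith : 1 - η ≤ _).trans (h2.symm.le.trans (prob_mono M _ fun y hy => ?_))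
        have ha' : 0 < |a (m + 1)| := abs_pos.2 ha
        have h3 : |a (m + 1) * (y - μ (m + 1))| ≤ e := by
          rw [abs_mul, mul_comm]
          exact ((lt_div_iff₀ ha').1 (not_le.1 hy)).le
        calc |x + a (m + 1) * y - (s + a (m + 1) * μ (m + 1))|
            = |(x - s) + a (m + 1) * (y - μ (m + 1))| := by congr 1; ring
          _ ≤ N * e + e := (abs_add_le _ _).trans (add_le_add hx h3)
          _ = ((N + 1 : ℕ) : ℝ) * e := by push_cast; ring
      · rw [mul_zero]
        exact prob_nonneg M _ _

end Walk

/-! ### The Laplacian of the full simplex -/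

section FullSimplex

variable {n : ℕ}

/-- The sign with which the vertex `v` is removed from the simplex `σ`. -/
def faceSign (v : Fin n) (σ : Finset (Fin n)) : ℝ :=
  (-1) ^ ((σ.filter fun u => u < v).card + 1)

theorem faceSign_mul_self (v : Fin n) (σ : Finset (Fin n)) :
    faceSign v σ * faceSign v σ = 1 := by
  rw [faceSign, ← pow_add, ← two_mul, pow_mul]
  norm_num

theorem abs_faceSign (v : Fin n) (σ : Finset (Fin n)) : |faceSign v σ| = 1 := by
  rw [faceSign, abs_pow, abs_neg, abs_one, one_pow]

theorem faceSign_insert_of_le {u v : Fin n} (h : v ≤ u) (σ : Finset (Fin n)) :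
    faceSign v (insert u σ) = faceSign v σ := by
  rw [faceSign, Finset.filter_insert, if_neg h.not_gt, faceSign]

theorem faceSign_insert_of_lt {u v : Fin n} (h : u < v) {σ : Finset (Fin n)} (hu : u ∉ σ) :
    faceSign v (insert u σ) = -faceSign v σ := by
  rw [faceSign, Finset.filter_insert, if_pos h, Finset.card_insert_of_notMem (by simp [hu]),
    faceSign, pow_succ]
  ring

theorem faceSign_erase_of_le {u v : Fin n} (h : v ≤ u) (σ : Finset (Fin n)) :
    faceSign v (σ.erase u) = faceSign v σ := by
  by_cases hu : u ∈ σ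
  · conv_rhs => rw [← Finset.insert_erase hu]
    rw [faceSign_insert_of_le h]
  · rw [Finset.erase_eq_of_notMem hu]

theorem faceSign_erase_of_lt {u v : Fin n} (h : u < v) {σ : Finset (Fin n)} (hu : u ∈ σ) :
    faceSign v (σ.erase u) = -faceSign v σ := by
  conv_rhs => rw [← Finset.insert_erase hu]
  rw [faceSign_insert_of_lt h (Finset.notMem_erase u σ), neg_neg]

/-- The part of the boundary map of the full simplex that removes the vertex `v`. -/
def removeVertex (v : Fin n) : Matrix (Finset (Fin n)) (Finset (Fin n)) ℝ :=
  fun ρ σ => if v ∈ σ ∧ σ.erase v = ρ then faceSign v σ else 0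

/-- The boundary map of the full simplex, in all dimensions at once. -/
def fullBoundary (n : ℕ) : Matrix (Finset (Fin n)) (Finset (Fin n)) ℝ :=
  fun ρ σ => ∑ v ∈ σ, if σ.erase v = ρ then
    (-1 : ℝ) ^ ((σ.filter (fun u => u < v)).card + 1) else 0

theorem fullBoundary_eq_sum : fullBoundary n = ∑ v, removeVertex v := by
  ext ρ σ
  rw [Matrix.sum_apply, fullBoundary, ← Finset.sum_filter_add_sum_filter_not Finset.univ (· ∈ σ),
    Finset.sum_eq_zero (s := Finset.univ.filter fun v => v ∉ σ) fun v hv => ?_, add_zero]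
  · refine Finset.sum_congr (by ext; simp) fun v hv => ?_
    simp [removeVertex, (Finset.mem_filter.1 hv).2, faceSign]
  · rw [removeVertex, if_neg fun h => (Finset.mem_filter.1 hv).2 h.1]

theorem removeVertex_mul_apply (u v : Fin n) (ρ κ : Finset (Fin n)) :
    (removeVertex u * removeVertex v) ρ κ =
      if v ∈ κ ∧ u ∈ κ.erase v ∧ (κ.erase v).erase u = ρ then
        faceSign u (κ.erase v) * faceSign v κ else 0 := by
  rw [Matrix.mul_apply, Finset.sum_eq_single (κ.erase v)]
  · simp only [removeVertex]
    split_ifs <;> simp_all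
  · intro σ _ hσ
    simp only [removeVertex]
    rw [if_neg (c := v ∈ κ ∧ κ.erase v = σ) fun h => hσ h.2.symm, mul_zero]
  · simp

/-- For u < v, removing u first changes by one the number of vertices below v, while removing v
first leaves the sign of u unchanged. Hence the two orders have opposite signs. -/
theorem removeVertex_anticomm (u v : Fin n) :
    removeVertex u * removeVertex v + removeVertex v * removeVertex u = 0 := by
  wlog huv : u ≤ v generalizing u v
  · rw [add_comm]
    exact this v u (le_of_not_ge huv)
  ext ρ κ
  rw [Matrix.add_apply, removeVertex_mul_apply, removeVertex_mul_apply, Matrix.zero_apply]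
  rcases huv.eq_or_lt with rfl | huv
  · simp
  · rw [Finset.erase_right_comm (a := u) (b := v)]
    by_cases h : u ∈ κ ∧ v ∈ κ ∧ (κ.erase v).erase u = ρ
    · rw [if_pos ⟨h.2.1, by simp [h.1, huv.ne], h.2.2⟩,
        if_pos ⟨h.1, by simp [h.2.1, huv.ne'], h.2.2⟩, faceSign_erase_of_le huv.le,
        faceSign_erase_of_lt huv h.1]
      ring
    · rw [if_neg fun h' => h ⟨Finset.mem_of_mem_erase h'.2.1, h'.1, h'.2.2⟩,
        if_neg fun h' => h ⟨h'.1, Finset.mem_of_mem_erase h'.2.1, h'.2.2⟩, add_zero]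

theorem fullBoundary_mul_self : fullBoundary n * fullBoundary n = 0 := by
  have h : fullBoundary n * fullBoundary n =
      -(fullBoundary n * fullBoundary n) := by
    rw [fullBoundary_eq_sum, Finset.sum_mul_sum]
    conv_lhs => rw [Finset.sum_comm]
    simp only [← Finset.sum_neg_distrib]
    refine Finset.sum_congr rfl fun u _ => Finset.sum_congr rfl fun v _ => ?_
    exact eq_neg_of_add_eq_zero_left (removeVertex_anticomm v u)
  ext i j
  have := congrFun (congrFun h i) j
  rw [Matrix.neg_apply] at this
  rw [Matrix.zero_apply]
  linarith

theorem transpose_removeVertex_mul_apply (u v : Fin n) (σ τ : Finset (Fin n)) :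
    ((removeVertex u)ᵀ * removeVertex v) σ τ =
      if u ∈ σ ∧ v ∈ τ ∧ τ.erase v = σ.erase u then faceSign u σ * faceSign v τ else 0 := by
  rw [Matrix.mul_apply, Finset.sum_eq_single (σ.erase u)]
  · simp only [removeVertex, Matrix.transpose_apply]
    split_ifs <;> simp_all
  · intro ρ _ hρ
    simp only [removeVertex, Matrix.transpose_apply]
    rw [if_neg (c := u ∈ σ ∧ σ.erase u = ρ) fun h => hρ h.2.symm, zero_mul]
  · simp

theorem removeVertex_mul_transpose_apply (u v : Fin n) (σ τ : Finset (Fin n)) :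
    (removeVertex v * (removeVertex u)ᵀ) σ τ =
      if v ∉ σ ∧ u ∈ insert v σ ∧ (insert v σ).erase u = τ then
        faceSign v σ * faceSign u (insert v σ) else 0 := by
  rw [Matrix.mul_apply, Finset.sum_eq_single (insert v σ)]
  · simp only [removeVertex, Matrix.transpose_apply]
    by_cases hv : v ∈ σ
    · rw [if_neg (c := v ∈ insert v σ ∧ (insert v σ).erase v = σ), zero_mul,
        if_neg fun h => h.1 hv]
      exact fun h => Finset.notMem_erase v (insert v σ) (h.2.symm ▸ hv)
    · rw [if_pos (c := v ∈ insert v σ ∧ (insert v σ).erase v = σ) ⟨Finset.mem_insert_self v σ, Finset.erase_insert hv⟩,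
        faceSign_insert_of_le le_rfl]
      simp [hv]
  · intro κ _ hκ
    simp only [removeVertex, Matrix.transpose_apply]
    rw [if_neg (c := v ∈ κ ∧ κ.erase v = σ), zero_mul]
    rintro ⟨h1, rfl⟩
    exact hκ (Finset.insert_erase h1).symm
  · simp

/-- The mixed canonical anticommutation relation, which makes the cross terms of the full Laplacian
cancel. For u = v the two products are the projections onto the sets that contain u and onto those
that do not. -/
theorem removeVertex_transpose_anticomm (u v : Fin n) :
    (removeVertex u)ᵀ * removeVertex v + removeVertex v * (removeVertex u)ᵀ =
      if u = v then 1 else 0 := by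
  ext σ τ
  rw [Matrix.add_apply, transpose_removeVertex_mul_apply, removeVertex_mul_transpose_apply]
  by_cases huv : u = v
  · subst huv
    rw [if_pos rfl, Matrix.one_apply]
    by_cases hu : u ∈ σ
    · rw [if_neg (c := u ∉ σ ∧ _) fun h => h.1 hu, add_zero]
      by_cases h : σ = τ
      · subst h
        rw [if_pos ⟨hu, hu, rfl⟩, if_pos rfl, faceSign_mul_self]
      · rw [if_neg h, if_neg]
        rintro ⟨-, h1, h2⟩
        exact h (by rw [← Finset.insert_erase hu, ← h2, Finset.insert_erase h1])
    · rw [if_neg (c := u ∈ σ ∧ _) fun h => hu h.1, zero_add, Finset.erase_insert hu,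
        faceSign_insert_of_le le_rfl, faceSign_mul_self]
      simp [hu]
  · rw [if_neg huv, Matrix.zero_apply]
    -- For u ≠ v both products only connect σ to the set in which v replaces u, and their signs
    -- there are opposite.
    by_cases h : u ∈ σ ∧ v ∉ σ ∧ τ = insert v (σ.erase u)
    · obtain ⟨hu, hv, rfl⟩ := h
      have hv' : v ∉ σ.erase u := fun h => hv (Finset.mem_of_mem_erase h)
      rw [if_pos ⟨hu, Finset.mem_insert_self _ _, Finset.erase_insert hv'⟩,
        if_pos ⟨hv, Finset.mem_insert_of_mem hu, Finset.erase_insert_of_ne (Ne.symm huv)⟩,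
        faceSign_insert_of_le le_rfl]
      rcases lt_or_gt_of_ne huv with h | h
      · rw [faceSign_erase_of_lt h hu, faceSign_insert_of_le h.le]
        ring
      · rw [faceSign_erase_of_le h.le, faceSign_insert_of_lt h hv]
        ring
    · rw [if_neg, if_neg, add_zero]
      · rintro ⟨hv, hu, rfl⟩
        exact h ⟨Finset.mem_of_mem_insert_of_ne hu huv, hv,
          Finset.erase_insert_of_ne (Ne.symm huv)⟩
      · rintro ⟨hu, hv, h1⟩
        refine h ⟨hu, fun hv' => ?_, ?_⟩
        · exact Finset.notMem_erase v τ (h1 ▸ Finset.mem_erase.2 ⟨Ne.symm huv, hv'⟩)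
        · rw [← h1, Finset.insert_erase hv]

/-- The Laplacian of the full simplex is `n` times the identity. -/
theorem fullLaplacian_eq :
    (fullBoundary n)ᵀ * fullBoundary n + fullBoundary n * (fullBoundary n)ᵀ = (n : ℝ) • 1 := by
  rw [fullBoundary_eq_sum, Matrix.transpose_sum, Finset.sum_mul_sum, Finset.sum_mul_sum]
  conv_lhs =>
    arg 2
    rw [Finset.sum_comm]
  simp only [← Finset.sum_add_distrib, removeVertex_transpose_anticomm, Finset.sum_ite_eq,
    Finset.mem_univ, if_true, Finset.sum_const, Finset.card_univ, Fintype.card_fin]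
  rw [Nat.cast_smul_eq_nsmul]

theorem fullBoundary_ne_zero {ρ σ : Finset (Fin n)} (h : fullBoundary n ρ σ ≠ 0) :
    ∃ v ∈ σ, σ.erase v = ρ := by
  obtain ⟨v, hv, h⟩ := Finset.exists_ne_zero_of_sum_ne_zero h
  exact ⟨v, hv, by by_contra h'; simp [h'] at h⟩

theorem abs_fullBoundary_le (ρ σ : Finset (Fin n)) :
    |fullBoundary n ρ σ| ≤ ∑ v, if v ∈ σ ∧ σ.erase v = ρ then (1 : ℝ) else 0 := by
  rw [fullBoundary_eq_sum, Matrix.sum_apply]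
  refine (Finset.abs_sum_le_sum_abs _ _).trans_eq (Finset.sum_congr rfl fun v _ => ?_)
  rw [removeVertex]
  split_ifs
  · exact abs_faceSign v σ
  · exact abs_zero

/-- Each vertex can be added to ρ to form at most one coface. -/
theorem sum_abs_fullBoundary_le (ρ : Finset (Fin n)) :
    ∑ σ, |fullBoundary n ρ σ| ≤ n := by
  refine (Finset.sum_le_sum fun σ _ => abs_fullBoundary_le ρ σ).trans ?_
  rw [Finset.sum_comm]
  refine (Finset.sum_le_card_nsmul _ _ 1 fun v _ => ?_).trans_eq (by simp)
  rw [Finset.sum_boole]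
  have : (Finset.univ.filter fun σ : Finset (Fin n) => v ∈ σ ∧ σ.erase v = ρ).card ≤ 1 := by
    refine Finset.card_le_one.2 fun σ hσ τ hτ => ?_
    have h1 := (Finset.mem_filter.1 hσ).2
    have h2 := (Finset.mem_filter.1 hτ).2
    rw [← Finset.insert_erase h1.1, ← Finset.insert_erase h2.1, h1.2, h2.2]
  exact_mod_cast this

end FullSimplex

/-! ### The Laplacian of a clique complex -/

section CliqueComplex

variable {n : ℕ} (G : SimpleGraph (Fin n))

open Classical in
theorem sum_cliqueOfCard (c : ℕ) (f : Finset (Fin n) → ℝ) :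
    ∑ x : CliqueOfCard G c, f x.1 = ∑ σ with G.IsNClique c σ, f σ :=
  (Finset.sum_subtype _ (by simp) f).symm

theorem sum_cliqueOfCard_of_ne_zero (c : ℕ) (f : Finset (Fin n) → ℝ)
    (hf : ∀ σ, f σ ≠ 0 → G.IsNClique c σ) : ∑ x : CliqueOfCard G c, f x.1 = ∑ σ, f σ := by
  classical
  rw [sum_cliqueOfCard]
  exact Finset.sum_filter_of_ne fun σ _ => hf σ

variable {G} in
theorem isNClique_of_fullBoundary_ne_zero {c : ℕ} {ρ σ : Finset (Fin n)}
    (hσ : G.IsNClique (c + 1) σ) (h : fullBoundary n ρ σ ≠ 0) : G.IsNClique c ρ := by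
  obtain ⟨v, hv, rfl⟩ := fullBoundary_ne_zero h
  exact hσ.erase_of_mem hv

theorem boundary_apply (k : ℕ) (τ : CliqueOfCard G k) (σ : Simplex G k) :
    boundary ℝ G k τ σ = fullBoundary n τ.1 σ.1 := rfl

theorem boundary_mul_boundary (k : ℕ) : boundary ℝ G k * boundary ℝ G (k + 1) = 0 := by
  ext τ σ
  rw [Matrix.mul_apply, Matrix.zero_apply]
  simp only [boundary_apply]
  rw [sum_cliqueOfCard_of_ne_zero G (k + 1)
    fun ρ => fullBoundary n τ.1 ρ * fullBoundary n ρ σ.1]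
  · exact congrFun (congrFun fullBoundary_mul_self τ.1) σ.1
  · exact fun ρ hρ => isNClique_of_fullBoundary_ne_zero σ.2 (right_ne_zero_of_mul hρ)

open Classical in
/-- `n` times the reflected Laplacian is a sum of rank one matrices over the simplices of the full
simplex that are not in the clique complex. -/
theorem smul_one_sub_laplacian_apply (k : ℕ) (σ τ : Simplex G k) :
    ((n : ℝ) • (1 : Matrix (Simplex G k) (Simplex G k) ℝ) - laplacian G k) σ τ =
      ∑ κ with ¬ G.IsNClique (k + 1 + 1) κ, fullBoundary n σ.1 κ * fullBoundary n τ.1 κ := by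
  have h := congrFun (congrFun (fullLaplacian_eq (n := n)) σ.1) τ.1
  rw [Matrix.add_apply, Matrix.mul_apply, Matrix.mul_apply, ← Finset.sum_filter_add_sum_filter_not
    Finset.univ (fun κ => G.IsNClique (k + 1 + 1) κ) fun κ => fullBoundary n σ.1 κ *
      (fullBoundary n)ᵀ κ τ.1] at h
  simp only [Matrix.transpose_apply] at h
  -- Facets of cliques are cliques, so the lower part agrees with that of the full simplex; only the
  -- upper part loses the non-clique cofaces.
  rw [← sum_cliqueOfCard G (k + 1 + 1) fun κ => fullBoundary n σ.1 κ * fullBoundary n τ.1 κ,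
    ← sum_cliqueOfCard_of_ne_zero G k (fun ρ => fullBoundary n ρ σ.1 * fullBoundary n ρ τ.1)
      fun ρ hρ => isNClique_of_fullBoundary_ne_zero σ.2 (left_ne_zero_of_mul hρ)] at h
  have h1 : ((1 : Matrix (Finset (Fin n)) (Finset (Fin n)) ℝ) σ.1 τ.1) =
      (1 : Matrix (Simplex G k) (Simplex G k) ℝ) σ τ := by
    rw [Matrix.one_apply, Matrix.one_apply]
    simp only [Subtype.ext_iff]
  rw [Matrix.smul_apply, h1] at h
  rw [Matrix.sub_apply, Matrix.smul_apply, ← h, laplacian, Matrix.add_apply, Matrix.mul_apply,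
    Matrix.mul_apply]
  simp only [Matrix.transpose_apply, boundary_apply]
  ring

theorem card_pos_of_simplex {k : ℕ} (σ : Simplex G k) : 0 < n := by
  have h : σ.1.card = k + 1 := σ.2.card_eq
  have := Finset.card_le_univ σ.1
  rw [Fintype.card_fin] at this
  omega

open Classical in
theorem reflLaplacian_apply (k : ℕ) (σ τ : Simplex G k) :
    reflLaplacian G k σ τ = 1 / (n : ℝ) *
      ∑ κ with ¬ G.IsNClique (k + 1 + 1) κ, fullBoundary n σ.1 κ * fullBoundary n τ.1 κ := by
  have hn : (n : ℝ) ≠ 0 := by exact_mod_cast (card_pos_of_simplex G σ).ne'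
  rw [← smul_one_sub_laplacian_apply, reflLaplacian, normLaplacian]
  simp only [Matrix.sub_apply, Matrix.smul_apply, smul_eq_mul]
  field_simp

open Classical in
/-- A set of vertices that is not a clique has at most two facets that are cliques. -/
theorem card_clique_facets_le_two {c : ℕ} {κ : Finset (Fin n)}
    (hκ : ¬ G.IsNClique (c + 1) κ) :
    (κ.filter fun v => G.IsNClique c (κ.erase v)).card ≤ 2 := by
  by_cases hc : κ.card = c + 1
  · have : ¬ G.IsClique κ := fun h => hκ ⟨h, hc⟩
    rw [SimpleGraph.isClique_iff, Set.Pairwise] at this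
    push Not at this
    obtain ⟨a, ha, b, hb, hab, hadj⟩ := this
    -- A facet that is a clique must omit an endpoint of the missing edge ab.
    refine (Finset.card_le_card (t := {a, b}) fun v hv => ?_).trans Finset.card_le_two
    rw [Finset.mem_filter] at hv
    by_contra h
    simp only [Finset.mem_insert, Finset.mem_singleton, not_or] at h
    refine hadj (hv.2.isClique ?_ ?_ hab) <;> simp only [Finset.coe_erase]
    · exact ⟨ha, fun h' => h.1 h'.symm⟩
    · exact ⟨hb, fun h' => h.2 h'.symm⟩
  · rw [Finset.filter_false_of_mem fun v hv h => hc ?_]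
    · simp
    · rw [← h.card_eq, Finset.card_erase_add_one hv]

theorem sum_abs_clique_facets_le_two {k : ℕ} {κ : Finset (Fin n)}
    (hκ : ¬ G.IsNClique (k + 1 + 1) κ) :
    ∑ σ : Simplex G k, |fullBoundary n σ.1 κ| ≤ 2 := by
  classical
  refine (Finset.sum_le_sum fun σ _ => abs_fullBoundary_le σ.1 κ).trans ?_
  rw [Finset.sum_comm]
  calc ∑ v, ∑ σ : Simplex G k, (if v ∈ κ ∧ κ.erase v = σ.1 then (1 : ℝ) else 0)
      ≤ ∑ v, if v ∈ κ ∧ G.IsNClique (k + 1) (κ.erase v) then (1 : ℝ) else 0 := by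
        refine Finset.sum_le_sum fun v _ => ?_
        rw [sum_cliqueOfCard G (k + 1) fun σ => if v ∈ κ ∧ κ.erase v = σ then (1 : ℝ) else 0]
        by_cases hv : v ∈ κ
        · simp [hv, Finset.sum_ite_eq]
        · simp [hv]
    _ = ((κ.filter fun v => G.IsNClique (k + 1) (κ.erase v)).card : ℝ) := by
        rw [Finset.sum_boole]
        congr 2
        ext v
        simp
    _ ≤ 2 := by exact_mod_cast card_clique_facets_le_two G hκ

/-- In the Gram expansion τ has at most n cofaces, and each non-clique among them has at most two
clique facets; the factor 1/n leaves 2. -/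
theorem sum_abs_reflLaplacian_le (k : ℕ) (τ : Simplex G k) :
    ∑ σ, |reflLaplacian G k σ τ| ≤ 2 := by
  classical
  have hn : (0 : ℝ) < n := by exact_mod_cast card_pos_of_simplex G τ
  calc ∑ σ, |reflLaplacian G k σ τ|
      ≤ ∑ σ : Simplex G k, 1 / (n : ℝ) * ∑ κ with ¬ G.IsNClique (k + 1 + 1) κ,
          |fullBoundary n σ.1 κ| * |fullBoundary n τ.1 κ| := by
        refine Finset.sum_le_sum fun σ _ => ?_
        rw [reflLaplacian_apply, abs_mul, abs_of_pos (by positivity)]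
        refine mul_le_mul_of_nonneg_left ?_ (by positivity)
        refine (Finset.abs_sum_le_sum_abs _ _).trans_eq ?_
        simp only [abs_mul]
    _ = 1 / (n : ℝ) * ∑ κ with ¬ G.IsNClique (k + 1 + 1) κ,
          (∑ σ : Simplex G k, |fullBoundary n σ.1 κ|) * |fullBoundary n τ.1 κ| := by
        rw [← Finset.mul_sum, Finset.sum_comm]
        simp only [Finset.sum_mul]
    _ ≤ 1 / (n : ℝ) * ∑ κ with ¬ G.IsNClique (k + 1 + 1) κ, 2 * |fullBoundary n τ.1 κ| := by
        refine mul_le_mul_of_nonneg_left (Finset.sum_le_sum fun κ hκ => ?_) (by positivity)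
        exact mul_le_mul_of_nonneg_right
          (sum_abs_clique_facets_le_two G (Finset.mem_filter.1 hκ).2) (abs_nonneg _)
    _ ≤ 1 / (n : ℝ) * (2 * n) := by
        refine mul_le_mul_of_nonneg_left ?_ (by positivity)
        rw [← Finset.mul_sum]
        refine mul_le_mul_of_nonneg_left ?_ zero_le_two
        exact (Finset.sum_le_sum_of_subset_of_nonneg (Finset.filter_subset _ _)
          fun _ _ _ => abs_nonneg _).trans (sum_abs_fullBoundary_le τ.1)
    _ = 2 := by field_simp

theorem oneNorm_reflLaplacian_le_two (k : ℕ) [Nonempty (Simplex G k)] :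
    oneNorm (reflLaplacian G k) ≤ 2 :=
  ciSup_le fun τ => sum_abs_reflLaplacian_le G k τ

theorem reflLaplacian_symm (k : ℕ) (σ τ : Simplex G k) :
    reflLaplacian G k σ τ = reflLaplacian G k τ σ := by
  classical
  rw [reflLaplacian_apply, reflLaplacian_apply]
  simp only [mul_comm]

theorem oneNorm_nonneg {ι : Type} [Fintype ι] (M : Matrix ι ι ℝ) : 0 ≤ oneNorm M :=
  Real.iSup_nonneg fun _ => Finset.sum_nonneg fun _ _ => abs_nonneg _

/-- The walk is weighted by row norms whereas `oneNorm` uses columns; symmetry of H reconciles them.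
-/
theorem sum_abs_row_reflLaplacian_le_oneNorm (k : ℕ) (σ : Simplex G k) :
    ∑ τ, |reflLaplacian G k σ τ| ≤ oneNorm (reflLaplacian G k) := by
  simp only [reflLaplacian_symm G k σ]
  exact le_ciSup (f := fun j => ∑ i, |reflLaplacian G k i j|) (Set.finite_range _).bddAbove σ

theorem reflLaplacian_posSemidef (k : ℕ) : (reflLaplacian G k).PosSemidef := by
  classical
  rcases Nat.eq_zero_or_pos n with rfl | hn
  · have : reflLaplacian G k = 0 := by
      ext σ
      exact absurd (card_pos_of_simplex G σ) (lt_irrefl 0)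
    rw [this]
    exact Matrix.PosSemidef.zero
  let F : Matrix (Simplex G k) {κ : Finset (Fin n) // ¬ G.IsNClique (k + 1 + 1) κ} ℝ :=
    fun σ κ => fullBoundary n σ.1 κ.1
  have : reflLaplacian G k = (1 / (n : ℝ)) • (F * Fᴴ) := by
    ext σ τ
    rw [reflLaplacian_apply, Matrix.smul_apply, smul_eq_mul, Matrix.mul_apply]
    congr 1
    exact Finset.sum_subtype _ (by simp) fun κ => fullBoundary n σ.1 κ * fullBoundary n τ.1 κ
  rw [this]
  exact (Matrix.posSemidef_self_mul_conjTranspose F).smul (by positivity)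

theorem laplacian_posSemidef (k : ℕ) : (laplacian G k).PosSemidef :=
  (Matrix.posSemidef_conjTranspose_mul_self (boundary ℝ G k)).add
    (Matrix.posSemidef_self_mul_conjTranspose (boundary ℝ G (k + 1)))

theorem normLaplacian_posSemidef (k : ℕ) : (normLaplacian G k).PosSemidef :=
  (laplacian_posSemidef G k).smul (by positivity)

end CliqueComplex

/-! ### Hodge theory and the spectrum of the Laplacian -/

section Hodge

open scoped ComplexOrder

variable {l m p : Type*} [Fintype l] [Fintype m] [Fintype p]

/-- Applying D to the Laplacian kills the E part and leaves D D† D x = 0; the identity ker A†A = ker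
A, used twice, gives D x = 0, and what is left of the equation gives E† x = 0. -/
theorem hodge_mulVec_eq_zero_iff {D : Matrix l m ℂ} {E : Matrix m p ℂ} (h : D * E = 0)
    (x : m → ℂ) : (Dᴴ * D + E * Eᴴ) *ᵥ x = 0 ↔ D *ᵥ x = 0 ∧ Eᴴ *ᵥ x = 0 := by
  constructor
  · intro hx
    have h1 : D * (Dᴴ * D + E * Eᴴ) = D * (Dᴴ * D) := by
      rw [Matrix.mul_add, ← Matrix.mul_assoc D E, h, Matrix.zero_mul, add_zero]
    have h2 : (D * (Dᴴ * D)) *ᵥ x = 0 := by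
      rw [← h1, ← Matrix.mulVec_mulVec, hx, Matrix.mulVec_zero]
    have h3 : D *ᵥ x = 0 := by
      rw [← Matrix.conjTranspose_mul_self_mulVec_eq_zero,
        ← Matrix.conjTranspose_mul_self_mulVec_eq_zero, Matrix.conjTranspose_mul, Matrix.conjTranspose_conjTranspose, Matrix.mul_assoc,
        ← Matrix.mulVec_mulVec, h2, Matrix.mulVec_zero]
    refine ⟨h3, ?_⟩
    rw [Matrix.add_mulVec, ← Matrix.mulVec_mulVec, h3, Matrix.mulVec_zero, zero_add] at hx
    exact (Matrix.self_mul_conjTranspose_mulVec_eq_zero E x).1 hx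
  · rintro ⟨h1, h2⟩
    rw [Matrix.add_mulVec, ← Matrix.mulVec_mulVec, h1, ← Matrix.mulVec_mulVec, h2,
      Matrix.mulVec_zero, Matrix.mulVec_zero, add_zero]

/-- Homology has dimension dim ker D - rank E. The kernel of the Laplacian is the kernel of E†
restricted to ker D, and this restriction still has rank equal to rank E, so both dimensions agree.
-/
theorem finrank_homology_add_rank {D : Matrix l m ℂ} {E : Matrix m p ℂ} (h : D * E = 0) :
    Module.finrank ℂ (LinearMap.ker D.mulVecLin ⧸
      (LinearMap.range E.mulVecLin).submoduleOf (LinearMap.ker D.mulVecLin)) +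
      (Dᴴ * D + E * Eᴴ).rank = Fintype.card m := by
  set K := LinearMap.ker D.mulVecLin with hK
  set L := (Dᴴ * D + E * Eᴴ) with hL
  have hEK : LinearMap.range E.mulVecLin ≤ K := by
    rintro _ ⟨y, rfl⟩
    rw [hK, LinearMap.mem_ker, Matrix.mulVecLin_apply, Matrix.mulVecLin_apply,
      Matrix.mulVec_mulVec, h, Matrix.zero_mulVec]
  have hLK : LinearMap.ker L.mulVecLin ≤ K := fun x hx =>
    ((hodge_mulVec_eq_zero_iff h x).1 hx).1
  have h1 := Submodule.finrank_quotient_add_finrank ((LinearMap.range E.mulVecLin).submoduleOf K)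
  rw [(Submodule.submoduleOfEquivOfLe hEK).finrank_eq] at h1
  have h2 : L.rank + Module.finrank ℂ (LinearMap.ker L.mulVecLin) = Fintype.card m := by
    rw [← Module.finrank_fintype_fun_eq_card ℂ (η := m)]
    exact LinearMap.finrank_range_add_finrank_ker L.mulVecLin
  let g := Eᴴ.mulVecLin.domRestrict K
  have h3 := LinearMap.finrank_range_add_finrank_ker g
  have hker : LinearMap.ker g = (LinearMap.ker L.mulVecLin).submoduleOf K := by
    ext ⟨x, hx⟩
    exact ⟨fun hg => (hodge_mulVec_eq_zero_iff h x).2 ⟨hx, hg⟩,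
      fun hg => ((hodge_mulVec_eq_zero_iff h x).1 hg).2⟩
  have hrange : Module.finrank ℂ (LinearMap.range g) = E.rank := by
    refine le_antisymm ?_ ?_
    · rw [← Matrix.rank_conjTranspose]
      exact Submodule.finrank_mono (LinearMap.range_domRestrict_le_range _ _)
    -- Since im E lies in ker D, the restricted E† already attains the whole range of E†E.
    · rw [← Matrix.rank_conjTranspose_mul_self]
      refine Submodule.finrank_mono ?_
      rintro _ ⟨y, rfl⟩
      refine ⟨⟨E *ᵥ y, hEK ⟨y, rfl⟩⟩, ?_⟩
      change Eᴴ *ᵥ (E *ᵥ y) = (Eᴴ * E) *ᵥ y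
      rw [Matrix.mulVec_mulVec]
  rw [hker, (Submodule.submoduleOfEquivOfLe hLK).finrank_eq, hrange] at h3
  have h4 : Module.finrank ℂ (LinearMap.range E.mulVecLin) = E.rank := rfl
  omega

end Hodge

/-! ### Traces and ranks from the eigenvalues of a real symmetric matrix. -/

section Spectrum

variable {ι : Type*} [Fintype ι] [DecidableEq ι]

theorem Matrix.IsHermitian.trace_one_sub_pow {A : Matrix ι ι ℝ} (hA : A.IsHermitian) (d : ℕ) :
    ((1 - A) ^ d).trace = ∑ i, (1 - hA.eigenvalues i) ^ d := by
  set φ := Unitary.conjStarAlgAut ℝ (Matrix ι ι ℝ) hA.eigenvectorUnitary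
  have h : (1 - A) ^ d = φ ((1 - Matrix.diagonal hA.eigenvalues) ^ d) := by
    rw [map_pow, map_sub, map_one]
    conv_lhs => rw [hA.spectral_theorem]
    rfl
  rw [h, Unitary.conjStarAlgAut_apply, Matrix.trace_mul_cycle, Unitary.coe_star_mul_self, one_mul,
    ← Matrix.diagonal_one, Matrix.diagonal_sub, Matrix.diagonal_pow, Matrix.trace_diagonal]
  rfl

/-- Betti numbers are taken over ℂ but the spectrum over ℝ; a real orthogonal eigenbasis remains
invertible over ℂ. -/
theorem Matrix.IsHermitian.rank_map_ofReal {A : Matrix ι ι ℝ} (hA : A.IsHermitian) :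
    (A.map Complex.ofReal).rank = Fintype.card {i // hA.eigenvalues i ≠ 0} := by
  set U : Matrix ι ι ℝ := hA.eigenvectorUnitary.1
  have h : A = U * Matrix.diagonal hA.eigenvalues * star U := by
    conv_lhs => rw [hA.spectral_theorem, Unitary.conjStarAlgAut_apply]
    rfl
  have hmul : ∀ X Y : Matrix ι ι ℝ, (X * Y).map Complex.ofReal =
      X.map Complex.ofReal * Y.map Complex.ofReal := fun X Y =>
    Matrix.map_mul (f := Complex.ofRealHom)
  have hU : U.map Complex.ofReal * (star U).map Complex.ofReal = 1 := by
    rw [← hmul, show U * star U = 1 from Unitary.coe_mul_star_self hA.eigenvectorUnitary]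
    exact Matrix.map_one _ Complex.ofReal_zero Complex.ofReal_one
  conv_lhs => rw [h]
  rw [hmul, hmul, Matrix.rank_mul_eq_left_of_isUnit_det _ _
      (Matrix.isUnit_det_of_left_inverse hU),
    Matrix.rank_mul_eq_right_of_isUnit_det _ _ (Matrix.isUnit_det_of_right_inverse hU),
    Matrix.diagonal_map Complex.ofReal_zero, Matrix.rank_diagonal]
  refine Fintype.card_congr (Equiv.subtypeEquivRight fun i => ?_)
  simp

end Spectrum

/-! ### Betti numbers and spectral gap of a clique complex. -/

section CliqueComplex

variable {n : ℕ} (G : SimpleGraph (Fin n)) (k : ℕ)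

theorem map_boundary : (boundary ℝ G k).map Complex.ofReal = boundary ℂ G k := by
  ext τ σ
  rw [Matrix.map_apply, boundary, boundary, Complex.ofReal_sum]
  refine Finset.sum_congr rfl fun v _ => ?_
  split_ifs <;> simp

theorem bettiNumber_add_rank :
    bettiNumber G k + ((normLaplacian G k).map Complex.ofReal).rank =
      Fintype.card (Simplex G k) := by
  have hmul : ∀ {a b c : Type} [Fintype b] (X : Matrix a b ℝ) (Y : Matrix b c ℝ),
      (X * Y).map Complex.ofReal = X.map Complex.ofReal * Y.map Complex.ofReal := fun X Y =>
    Matrix.map_mul (f := Complex.ofRealHom)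
  have htr : ∀ {a b : Type} (X : Matrix a b ℝ),
      Xᵀ.map Complex.ofReal = (X.map Complex.ofReal)ᴴ := fun X => by
    ext i j
    simp
  have h0 : boundary ℂ G k * boundary ℂ G (k + 1) = 0 := by
    rw [← map_boundary, ← map_boundary, ← hmul, boundary_mul_boundary]
    exact Matrix.map_zero _ Complex.ofReal_zero
  rw [← finrank_homology_add_rank h0, bettiNumber]
  congr 1
  rcases isEmpty_or_nonempty (Simplex G k) with he | ⟨⟨σ⟩⟩
  · rw [Subsingleton.elim ((normLaplacian G k).map Complex.ofReal)]
  have hn : (n : ℂ) ≠ 0 := by exact_mod_cast (card_pos_of_simplex G σ).ne'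
  rw [← Matrix.rank_smul_of_mem_nonZeroDivisors (c := (1 / (n : ℂ)))
    ((boundary ℂ G k)ᴴ * boundary ℂ G k + boundary ℂ G (k + 1) * (boundary ℂ G (k + 1))ᴴ)
    (mem_nonZeroDivisors_of_ne_zero (by simpa using hn))]
  congr 1
  rw [← map_boundary, ← map_boundary, ← htr, ← htr, ← hmul, ← hmul]
  ext σ τ
  simp [normLaplacian, laplacian, mul_add]

/-- The eigenvalues of the normalised Laplacian. -/
noncomputable def lapEigenvalues : Simplex G k → ℝ := (normLaplacian_posSemidef G k).1.eigenvalues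

theorem trace_reflLaplacian_pow (d : ℕ) :
    ((reflLaplacian G k) ^ d).trace = ∑ i, (1 - lapEigenvalues G k i) ^ d :=
  (normLaplacian_posSemidef G k).1.trace_one_sub_pow d

theorem bettiNumber_eq_card : bettiNumber G k = Fintype.card {i // lapEigenvalues G k i = 0} := by
  have h := bettiNumber_add_rank G k
  rw [(normLaplacian_posSemidef G k).1.rank_map_ofReal] at h
  have h2 := Fintype.card_subtype_compl fun i => lapEigenvalues G k i = 0
  have h3 := Fintype.card_subtype_le fun i => lapEigenvalues G k i = 0
  have h4 : Fintype.card {i // ¬ lapEigenvalues G k i = 0} =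
    Fintype.card {i // (normLaplacian_posSemidef G k).1.eigenvalues i ≠ 0} := rfl
  omega

theorem lapEigenvalues_nonneg (i : Simplex G k) : 0 ≤ lapEigenvalues G k i :=
  (normLaplacian_posSemidef G k).eigenvalues_nonneg i

theorem exists_eigenvector (i : Simplex G k) : ∃ v : Simplex G k → ℝ, v ≠ 0 ∧
    normLaplacian G k *ᵥ v = lapEigenvalues G k i • v := by
  set hA := (normLaplacian_posSemidef G k).1
  refine ⟨(hA.eigenvectorBasis i).ofLp, fun h => ?_, hA.mulVec_eigenvectorBasis i⟩
  refine hA.eigenvectorBasis.orthonormal.ne_zero i ?_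
  ext j
  exact congrFun h j

/-- An eigenvector with eigenvalue above 1 would contradict H ≥ 0. -/
theorem lapEigenvalues_le_one (i : Simplex G k) : lapEigenvalues G k i ≤ 1 := by
  obtain ⟨v, hv, h⟩ := exists_eigenvector G k i
  have h1 := (reflLaplacian_posSemidef G k).dotProduct_mulVec_nonneg v
  rw [reflLaplacian, Matrix.sub_mulVec, Matrix.one_mulVec, h, dotProduct_sub, dotProduct_smul,
    smul_eq_mul] at h1
  have h2 : 0 < star v ⬝ᵥ v :=
    (dotProduct_star_self_nonneg v).lt_of_ne' fun h => hv (dotProduct_star_self_eq_zero.1 h)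
  by_contra hlt
  rw [not_le] at hlt
  nlinarith

variable {G k}

theorem IsGapBound.le_lapEigenvalues {δ : ℝ} (hδ : IsGapBound G k δ) (i : Simplex G k)
    (hi : lapEigenvalues G k i ≠ 0) : δ ≤ lapEigenvalues G k i := by
  refine hδ.2 _ ?_ ((lapEigenvalues_nonneg G k i).lt_of_ne' hi)
  obtain ⟨v, hv, h⟩ := exists_eigenvector G k i
  exact Module.End.hasEigenvalue_of_hasEigenvector (x := v)
    (Module.End.hasEigenvector_iff.2 ⟨Module.End.mem_eigenspace_iff.2 h, hv⟩)

theorem laplacian_diag_pos (σ : Simplex G k) : 0 < laplacian G k σ σ := by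
  have hne : ∀ v ∈ σ.1, G.IsNClique k (σ.1.erase v) := fun v hv => σ.2.erase_of_mem hv
  have hcard : 0 < σ.1.card := by
    rw [σ.2.card_eq]
    exact Nat.succ_pos k
  obtain ⟨v, hv⟩ := Finset.card_pos.1 hcard
  have hb : boundary ℝ G k ⟨σ.1.erase v, hne v hv⟩ σ = faceSign v σ.1 := by
    rw [boundary, Finset.sum_eq_single v]
    · exact if_pos rfl
    · intro u hu huv
      exact if_neg fun h => huv ((Finset.erase_inj σ.1 hu).1 h)
    · exact fun h => absurd hv h
  rw [laplacian, Matrix.add_apply, Matrix.mul_apply, Matrix.mul_apply]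
  refine add_pos_of_pos_of_nonneg ?_ (Finset.sum_nonneg fun κ _ => mul_self_nonneg _)
  refine Finset.sum_pos' (fun ρ _ => mul_self_nonneg _) ⟨⟨_, hne v hv⟩, Finset.mem_univ _, ?_⟩
  rw [Matrix.transpose_apply, hb, faceSign_mul_self]
  exact zero_lt_one

/-- If δ > 1, every eigenvalue is 0, but the diagonal of the Laplacian is positive, hence so is its
trace. The bound keeps log(2/ε)/δ away from 0, so that its ceiling costs only a constant factor. -/
theorem IsGapBound.le_one [Nonempty (Simplex G k)] {δ : ℝ} (hδ : IsGapBound G k δ) : δ ≤ 1 := by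
  by_contra hlt
  have h0 : ∀ i, lapEigenvalues G k i = 0 := fun i => by
    by_contra hi
    exact hlt ((hδ.le_lapEigenvalues i hi).trans (lapEigenvalues_le_one G k i))
  have h1 : (normLaplacian G k).trace = ∑ i, lapEigenvalues G k i :=
    (normLaplacian_posSemidef G k).1.trace_eq_sum_eigenvalues
  have h2 : 0 < (normLaplacian G k).trace := by
    refine Finset.sum_pos (fun σ _ => ?_) Finset.univ_nonempty
    have hn : (0 : ℝ) < n := by exact_mod_cast card_pos_of_simplex G σ
    rw [Matrix.diag_apply, normLaplacian, Matrix.smul_apply, smul_eq_mul]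
    exact mul_pos (by positivity) (laplacian_diag_pos σ)
  simp [h0] at h1
  linarith

/-- A function that is `1` at `1` and at most `e` on the rest of the spectrum of `H` has a
normalised trace that is `e`-close to the normalised Betti number. -/
theorem abs_trace_sub_normalisedBetti_le [Nonempty (Simplex G k)] {δ e : ℝ} {f : ℝ → ℝ}
    (hδ : IsGapBound G k δ) (he : 0 ≤ e) (h1 : f 1 = 1)
    (hf : ∀ x, 0 ≤ x → x ≤ 1 - δ → |f x| ≤ e) :
    |(∑ i, f (1 - lapEigenvalues G k i)) / Fintype.card (Simplex G k) -
      normalisedBetti G k| ≤ e := by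
  have hN : (0 : ℝ) < Fintype.card (Simplex G k) := by exact_mod_cast Fintype.card_pos
  rw [normalisedBetti, ← sub_div, abs_div, abs_of_pos hN, div_le_iff₀ hN, bettiNumber_eq_card,
    Fintype.card_subtype, ← Finset.sum_boole, ← Finset.sum_sub_distrib]
  refine (Finset.abs_sum_le_sum_abs _ _).trans ((Finset.sum_le_card_nsmul _ _ e fun i _ => ?_).trans_eq
    (by rw [Finset.card_univ, nsmul_eq_mul, mul_comm]))
  split_ifs with hi
  · rw [hi, sub_zero, h1, sub_self, abs_zero]
    exact he
  · rw [sub_zero]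
    exact hf _ (by linarith [lapEigenvalues_le_one G k i])
      (by linarith [hδ.le_lapEigenvalues i hi])

end CliqueComplex

/-! ### Chebyshev polynomials -/

section Chebyshev

open Polynomial

theorem Polynomial.Chebyshev.T_natCast_add_two (d : ℕ) :
    Chebyshev.T ℝ ((d + 2 : ℕ) : ℤ) =
      Polynomial.C 2 * (X * Chebyshev.T ℝ ((d + 1 : ℕ) : ℤ)) - Chebyshev.T ℝ (d : ℤ) := by
  push_cast
  rw [Chebyshev.T_add_two, ← mul_assoc, Polynomial.C_ofNat]

/-- In T_{d+2} = 2yT_{d+1} - T_d, one copy of yT_{d+1} dominates T_d; positivity is carried along to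
make the induction close. -/
theorem Polynomial.Chebyshev.mul_eval_T_le {y : ℝ} (hy : 1 ≤ y) (d : ℕ) :
    0 < (Chebyshev.T ℝ (d : ℤ)).eval y ∧
      y * (Chebyshev.T ℝ (d : ℤ)).eval y ≤ (Chebyshev.T ℝ ((d + 1 : ℕ) : ℤ)).eval y := by
  induction d with
  | zero => simp
  | succ d ih =>
    obtain ⟨h1, h2⟩ := ih
    rw [Chebyshev.T_natCast_add_two]
    simp only [eval_sub, eval_mul, eval_C, eval_X]
    have h3 := h1.trans_le ((le_mul_of_one_le_left h1.le hy).trans h2)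
    exact ⟨h3, by linarith [le_mul_of_one_le_left h1.le hy, le_mul_of_one_le_left h3.le hy]⟩

theorem Polynomial.Chebyshev.pow_le_eval_T {y : ℝ} (hy : 1 ≤ y) (d : ℕ) :
    y ^ d ≤ (Chebyshev.T ℝ (d : ℤ)).eval y := by
  induction d with
  | zero => simp
  | succ d ih =>
    rw [pow_succ']
    exact (mul_le_mul_of_nonneg_left ih (by linarith)).trans (mul_eval_T_le hy d).2

/-- The recurrence at most doubles and adds: 2·3^(d+1) + 3^d ≤ 3^(d+2). -/
theorem Polynomial.Chebyshev.abs_coeff_T_le (d i : ℕ) :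
    |(Chebyshev.T ℝ (d : ℤ)).coeff i| ≤ 3 ^ d := by
  induction d using Nat.twoStepInduction generalizing i with
  | zero =>
    simp only [Nat.cast_zero, Chebyshev.T_zero, coeff_one, pow_zero]
    split_ifs <;> simp
  | one =>
    simp only [Nat.cast_one, Chebyshev.T_one, coeff_X, pow_one]
    split_ifs <;> simp
  | more d h0 h1 =>
    rw [Chebyshev.T_natCast_add_two, coeff_sub, coeff_C_mul]
    have hx : |(X * Chebyshev.T ℝ ((d + 1 : ℕ) : ℤ)).coeff i| ≤ 3 ^ (d + 1) := by
      cases i with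
      | zero => simp
      | succ i =>
        rw [coeff_X_mul]
        exact h1 i
    refine (abs_sub _ _).trans ?_
    rw [abs_mul, abs_two]
    have := h0 i
    have h3 : (0 : ℝ) < 3 ^ d := by positivity
    rw [pow_succ] at hx
    rw [pow_add]
    linarith

theorem Polynomial.Chebyshev.coeff_T_eq_zero (d i : ℕ) (h : i % 2 ≠ d % 2) :
    (Chebyshev.T ℝ (d : ℤ)).coeff i = 0 := by
  induction d using Nat.twoStepInduction generalizing i with
  | zero =>
    simp only [Nat.cast_zero, Chebyshev.T_zero, coeff_one]
    exact if_neg (by omega)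
  | one =>
    simp only [Nat.cast_one, Chebyshev.T_one, coeff_X]
    exact if_neg (by omega)
  | more d h0 h1 =>
    rw [Chebyshev.T_natCast_add_two, coeff_sub, coeff_C_mul, h0 i (by omega)]
    cases i with
    | zero => simp
    | succ i =>
      rw [coeff_X_mul, h1 i (by omega)]
      simp

/-- The source of the quadratic gain from δ to √δ: the point 1/(1 - δ) is at hyperbolic angle at
least √δ. -/
theorem cosh_le_one_div_one_sub {δ : ℝ} (h0 : 0 < δ) (h1 : δ < 1) :
    Real.cosh √δ ≤ 1 / (1 - δ) := by
  refine (Real.cosh_le_exp_half_sq _).trans ?_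
  rw [Real.sq_sqrt h0.le, le_div_iff₀ (by linarith)]
  have h2 := Real.add_one_le_exp (-δ)
  calc Real.exp (δ / 2) * (1 - δ) ≤ Real.exp δ * Real.exp (-δ) :=
        mul_le_mul (Real.exp_le_exp.2 (by linarith)) (by linarith) (by linarith)
          (Real.exp_pos _).le
    _ = 1 := by rw [← Real.exp_add, add_neg_cancel, Real.exp_zero]

theorem cosh_mul_le_eval_T {t y : ℝ} (ht : 0 ≤ t) (hy : Real.cosh t ≤ y) (d : ℕ) :
    Real.cosh (d * t) ≤ (Chebyshev.T ℝ (d : ℤ)).eval y := by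
  have hy1 : 1 ≤ y := (Real.one_le_cosh t).trans hy
  have hθ := Real.arcosh_nonneg hy1
  rw [← Real.cosh_arcosh hy1, Real.cosh_le_cosh, abs_of_nonneg ht, abs_of_nonneg hθ] at hy
  conv_rhs => rw [← Real.cosh_arcosh hy1]
  rw [Chebyshev.T_real_cosh, Real.cosh_le_cosh, Int.cast_natCast, abs_of_nonneg (by positivity),
    abs_of_nonneg (by positivity)]
  exact mul_le_mul_of_nonneg_left hy (Nat.cast_nonneg d)

variable {δ ε : ℝ}

theorem one_le_one_div_one_sub (h0 : 0 < δ) (h1 : δ < 1) : 1 ≤ 1 / (1 - δ) := by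
  rw [le_div_iff₀ (by linarith)]
  linarith

theorem two_div_lt_eval_T (h0 : 0 < δ) (h1 : δ < 1) (hε : 0 < ε) :
    2 / ε < (Chebyshev.T ℝ (chebDegree δ ε : ℤ)).eval (1 / (1 - δ)) := by
  refine lt_of_lt_of_le ?_
    (cosh_mul_le_eval_T (Real.sqrt_nonneg δ) (cosh_le_one_div_one_sub h0 h1) _)
  have hs : 0 < √δ := Real.sqrt_pos.2 h0
  have hd : Real.log (4 / ε) ≤ chebDegree δ ε * √δ :=
    (div_le_iff₀ hs).1 (Nat.le_ceil (Real.log (4 / ε) / √δ))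
  have he : 4 / ε ≤ Real.exp (chebDegree δ ε * √δ) := by
    rw [← Real.exp_log (by positivity : 0 < 4 / ε)]
    exact Real.exp_le_exp.2 hd
  rw [Real.cosh_eq]
  have h2 : 2 / ε = 4 / ε / 2 := by ring
  rw [h2]
  -- The inequality is strict because the second exponential in cosh is positive.
  linarith [Real.exp_pos (-(chebDegree δ ε * √δ))]

theorem eval_chebPoly (x : ℝ) : (chebPoly δ ε).eval x =
    (Chebyshev.T ℝ (chebDegree δ ε : ℤ)).eval (x / (1 - δ)) /
      (Chebyshev.T ℝ (chebDegree δ ε : ℤ)).eval (1 / (1 - δ)) := by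
  simp only [chebPoly, eval_mul, eval_C, eval_comp, eval_X]
  rw [one_div_mul_eq_div, one_div_mul_eq_div]

theorem eval_chebPoly_one (h0 : 0 < δ) (h1 : δ < 1) : (chebPoly δ ε).eval 1 = 1 := by
  rw [eval_chebPoly, div_self (Chebyshev.mul_eval_T_le (one_le_one_div_one_sub h0 h1) _).1.ne']

theorem abs_eval_chebPoly_le (h0 : 0 < δ) (h1 : δ < 1) {x : ℝ} (hx0 : 0 ≤ x) (hx : x ≤ 1 - δ) :
    |(chebPoly δ ε).eval x| ≤
      1 / (Chebyshev.T ℝ (chebDegree δ ε : ℤ)).eval (1 / (1 - δ)) := by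
  have hT := (Chebyshev.mul_eval_T_le (one_le_one_div_one_sub h0 h1) (chebDegree δ ε)).1
  rw [eval_chebPoly, abs_div, abs_of_pos hT]
  refine div_le_div_of_nonneg_right (Chebyshev.abs_eval_T_real_le_one _ ?_) hT.le
  rw [abs_of_nonneg (div_nonneg hx0 (by linarith))]
  exact div_le_one_of_le₀ hx (by linarith)

theorem coeff_chebPoly (i : ℕ) : (chebPoly δ ε).coeff i =
    (Chebyshev.T ℝ (chebDegree δ ε : ℤ)).coeff i * (1 / (1 - δ)) ^ i /
      (Chebyshev.T ℝ (chebDegree δ ε : ℤ)).eval (1 / (1 - δ)) := by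
  rw [chebPoly, coeff_C_mul, comp_C_mul_X_coeff]
  ring

theorem natDegree_chebPoly_le : (chebPoly δ ε).natDegree ≤ chebDegree δ ε := by
  rw [natDegree_le_iff_coeff_eq_zero]
  intro i hi
  rw [coeff_chebPoly, coeff_eq_zero_of_natDegree_lt (by rwa [Chebyshev.natDegree_T]), zero_mul,
    zero_div]

/-- The rescaling factor (1/(1 - δ))^i is absorbed by the denominator, which is at least (1/(1 -
δ))^d. -/
theorem abs_coeff_chebPoly_le (h0 : 0 < δ) (h1 : δ < 1) (i : ℕ) :
    |(chebPoly δ ε).coeff i| ≤ 3 ^ chebDegree δ ε := by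
  rcases le_or_gt i (chebDegree δ ε) with hi | hi
  · have hy := one_le_one_div_one_sub h0 h1
    have hT := (Chebyshev.mul_eval_T_le hy (chebDegree δ ε)).1
    have hyi : (1 / (1 - δ)) ^ i ≤ (Chebyshev.T ℝ (chebDegree δ ε : ℤ)).eval (1 / (1 - δ)) :=
      (pow_le_pow_right₀ hy hi).trans (Chebyshev.pow_le_eval_T hy _)
    have hpos : 0 ≤ (1 / (1 - δ)) ^ i := pow_nonneg (by linarith) i
    rw [coeff_chebPoly, abs_div, abs_mul, abs_of_pos hT, abs_of_nonneg hpos,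
      div_le_iff₀ hT]
    exact mul_le_mul (Chebyshev.abs_coeff_T_le _ i) hyi hpos (by positivity)
  · rw [coeff_eq_zero_of_natDegree_lt (natDegree_chebPoly_le.trans_lt hi), abs_zero]
    positivity

theorem support_chebPoly_subset : (chebPoly δ ε).support ⊆ Finset.range (chebDegree δ ε + 1) :=
  fun i hi => Finset.mem_range.2 (Nat.lt_succ_of_le
    ((le_natDegree_of_mem_supp i hi).trans natDegree_chebPoly_le))

theorem sq_coeffNorm (p : ℝ[X]) : coeffNorm p ^ 2 = ∑ i ∈ p.support, p.coeff i ^ 2 :=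
  Real.sq_sqrt (Finset.sum_nonneg fun _ _ => sq_nonneg _)

theorem sum_sq_coeff_le (p : ℝ[X]) (s : Finset ℕ) :
    ∑ i ∈ s, p.coeff i ^ 2 ≤ coeffNorm p ^ 2 := by
  rw [sq_coeffNorm, ← Finset.sum_filter_of_ne (p := fun i => p.coeff i ≠ 0)
    fun i _ h h' => h (by rw [h', zero_pow two_ne_zero])]
  exact Finset.sum_le_sum_of_subset_of_nonneg
    (fun i hi => mem_support_iff.2 (Finset.mem_filter.1 hi).2) fun _ _ _ => sq_nonneg _

theorem sq_coeffNorm_chebPoly_le (h0 : 0 < δ) (h1 : δ < 1) :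
    coeffNorm (chebPoly δ ε) ^ 2 ≤ 32 ^ chebDegree δ ε := by
  rw [sq_coeffNorm]
  refine (Finset.sum_le_sum_of_subset_of_nonneg support_chebPoly_subset
    fun _ _ _ => sq_nonneg _).trans ?_
  refine (Finset.sum_le_card_nsmul _ _ ((3 ^ chebDegree δ ε) ^ 2) fun i _ => ?_).trans ?_
  · exact sq_le_sq' (abs_le.1 (abs_coeff_chebPoly_le h0 h1 i)).1
      (abs_le.1 (abs_coeff_chebPoly_le h0 h1 i)).2
  · have h : ((chebDegree δ ε + 1 : ℕ) : ℝ) ≤ 2 ^ chebDegree δ ε := by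
      exact_mod_cast Nat.lt_two_pow_self
    rw [Finset.card_range, nsmul_eq_mul]
    -- With 9 rounded up to 16 the base becomes 32 = 2^5, a power of 2 as needed for the final
    -- bound.
    calc ((chebDegree δ ε + 1 : ℕ) : ℝ) * (3 ^ chebDegree δ ε) ^ 2
        ≤ 2 ^ chebDegree δ ε * 16 ^ chebDegree δ ε := by
          refine mul_le_mul h ?_ (by positivity) (by positivity)
          rw [← pow_mul, mul_comm, pow_mul]
          gcongr
          norm_num
      _ = 32 ^ chebDegree δ ε := by
          rw [← mul_pow]
          norm_num

/-- Cauchy–Schwarz for p(1) = 1. This lower bound lets the extra sample from each ceiling be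
absorbed into a multiple of ‖p‖₂². -/
theorem one_le_mul_sq_coeffNorm_chebPoly (h0 : 0 < δ) (h1 : δ < 1) :
    1 ≤ ((chebDegree δ ε : ℝ) + 1) * coeffNorm (chebPoly δ ε) ^ 2 := by
  have h := eval_chebPoly_one (ε := ε) h0 h1
  rw [eval_eq_sum, Polynomial.sum] at h
  simp only [one_pow, mul_one] at h
  have h2 := sq_sum_le_card_mul_sum_sq (s := (chebPoly δ ε).support)
    (f := fun i => (chebPoly δ ε).coeff i)
  rw [h, one_pow, ← sq_coeffNorm] at h2
  refine h2.trans (mul_le_mul_of_nonneg_right ?_ (sq_nonneg _))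
  have := Finset.card_le_card (support_chebPoly_subset (δ := δ) (ε := ε))
  rw [Finset.card_range] at this
  exact_mod_cast this

theorem card_coeff_chebPoly_ne_zero_le :
    ((Finset.Icc 1 (chebDegree δ ε)).filter fun i => (chebPoly δ ε).coeff i ≠ 0).card ≤
      ⌈(chebDegree δ ε : ℝ) / 2⌉₊ := by
  set d := chebDegree δ ε with hd
  set m := ⌈(d : ℝ) / 2⌉₊ with hm
  have hdm : d ≤ 2 * m := by
    have : (d : ℝ) / 2 ≤ m := Nat.le_ceil _
    have : (d : ℝ) ≤ 2 * m := by linarith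
    exact_mod_cast this
  have hpar : ∀ i, (chebPoly δ ε).coeff i ≠ 0 → i % 2 = d % 2 := fun i hi => by
    by_contra h
    rw [coeff_chebPoly, Chebyshev.coeff_T_eq_zero _ i h, zero_mul, zero_div] at hi
    exact hi rfl
  conv_rhs => rw [← Finset.card_range m]
  -- Nonzero coefficients have the parity of d, and on one parity class of positive integers this
  -- map is injective.
  refine Finset.card_le_card_of_injOn (fun i => (i - 1) / 2) (fun i hi => ?_)
    fun i hi j hj hij => ?_
  · have hi := Finset.mem_Icc.1 (Finset.mem_filter.1 hi).1
    simp only [Finset.coe_range, Set.mem_Iio]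
    omega
  · obtain ⟨hi1, hi2⟩ := Finset.mem_filter.1 hi
    obtain ⟨hj1, hj2⟩ := Finset.mem_filter.1 hj
    have hi1 := Finset.mem_Icc.1 hi1
    have hj1 := Finset.mem_Icc.1 hj1
    have hi2 := hpar i hi2
    have hj2 := hpar j hj2
    simp only at hij
    omega

end Chebyshev

/-! ### Sample numbers -/

section Counting

theorem half_le_log_two_div {x : ℝ} (h0 : 0 < x) (h1 : x ≤ 1) : 1 / 2 ≤ Real.log (2 / x) := by
  have h : Real.log 2 ≤ Real.log (2 / x) :=
    Real.log_le_log two_pos (by rw [le_div_iff₀ h0]; linarith)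
  linarith [Real.log_two_gt_d9]

theorem one_le_log_four_div {x : ℝ} (h0 : 0 < x) (h1 : x ≤ 1) : 1 ≤ Real.log (4 / x) := by
  have h : Real.log 4 ≤ Real.log (4 / x) :=
    Real.log_le_log four_pos (by rw [le_div_iff₀ h0]; linarith)
  have h4 : Real.log 4 = 2 * Real.log 2 := by
    rw [show (4 : ℝ) = 2 ^ 2 by norm_num, Real.log_pow]
    norm_num
  linarith [Real.log_two_gt_d9]

theorem shots_le {R ε η : ℝ} (hη : 0 < η) (hη1 : η ≤ 1) :
    (shots R ε η : ℝ) ≤ 2 * R ^ 2 * Real.log (2 / η) / ε ^ 2 + 1 := by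
  have hl := half_le_log_two_div hη hη1
  refine (Nat.ceil_lt_add_one (by positivity)).le.trans_eq ?_
  congr 1
  rw [show (2 * R) ^ 2 * Real.log (2 / η) = 2 * (2 * R ^ 2 * Real.log (2 / η)) by ring,
    mul_div_mul_left _ _ two_ne_zero]

/-- A power with rounded-up exponent, squared, is at most four times the power with the exact
exponent. -/
theorem sq_pow_le_four_mul_rpow {h D : ℝ} {d : ℕ} (h0 : 0 ≤ h) (h2 : h ≤ 2) (hD : 0 < D)
    (hd : D ≤ d) (hd1 : (d : ℝ) ≤ D + 1) : (h ^ d) ^ 2 ≤ 4 * h ^ (2 * D) := by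
  have e : (h ^ d) ^ 2 = h ^ (2 * (d : ℝ)) := by
    rw [← pow_mul, ← Real.rpow_natCast]
    congr 1
    push_cast
    ring
  rw [e]
  -- Rounding the exponent up decreases a power with base at most 1; otherwise it costs at most h² ≤
  -- 4.
  rcases le_total h 1 with h1 | h1
  · have := Real.rpow_le_rpow_of_exponent_ge' h0 h1 (by positivity : 0 ≤ 2 * D)
      (by linarith : 2 * D ≤ 2 * (d : ℝ))
    linarith [Real.rpow_nonneg h0 (2 * D)]
  · calc h ^ (2 * (d : ℝ)) ≤ h ^ (2 * D + 2) :=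
          Real.rpow_le_rpow_of_exponent_le h1 (by linarith)
      _ = h ^ (2 * D) * h ^ 2 := by
          rw [Real.rpow_add (by linarith)]
          norm_cast
      _ ≤ h ^ (2 * D) * 2 ^ 2 := by gcongr
      _ = 4 * h ^ (2 * D) := by ring

/-- Ceilings are absorbed by 1 ≤ 2D and 1 ≤ 2Λ: the degree is at most 3D and the sample number at
most (8 + 2)Λ times the maximum, whence 30. -/
theorem powerDegree_mul_shots_le {δ ε η R : ℝ} (h0 : 0 < δ) (h1 : δ ≤ 1) (hε : 0 < ε)
    (hε1 : ε ≤ 1) (hη : 0 < η) (hη1 : η < 1) :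
    ((shots R (ε / 2) η * powerDegree δ ε : ℕ) : ℝ) ≤
      30 * Real.log (2 / η) * (Real.log (2 / ε) / δ) * max 1 (R ^ 2 / ε ^ 2) := by
  have hL := half_le_log_two_div hε hε1
  have hΛ := half_le_log_two_div hη hη1.le
  set D := Real.log (2 / ε) / δ with hD
  set Λ := Real.log (2 / η)
  have hDL : 1 / 2 ≤ D := hL.trans (le_div_self (by linarith) h0 h1)
  have hd : (powerDegree δ ε : ℝ) ≤ 3 * D :=
    (Nat.ceil_lt_add_one (by linarith : 0 ≤ D)).le.trans (by linarith)
  have hq : (shots R (ε / 2) η : ℝ) ≤ 10 * Λ * max 1 (R ^ 2 / ε ^ 2) := by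
    refine (shots_le hη hη1.le).trans ?_
    have e : 2 * R ^ 2 * Λ / (ε / 2) ^ 2 = 8 * Λ * (R ^ 2 / ε ^ 2) := by
      field_simp
      ring
    rw [e]
    have m1 := mul_le_mul_of_nonneg_left (le_max_left 1 (R ^ 2 / ε ^ 2)) (by linarith : 0 ≤ 2 * Λ)
    have m2 := mul_le_mul_of_nonneg_left (le_max_right 1 (R ^ 2 / ε ^ 2)) (by linarith : 0 ≤ 8 * Λ)
    linarith
  push_cast
  calc (shots R (ε / 2) η : ℝ) * powerDegree δ ε
      ≤ (10 * Λ * max 1 (R ^ 2 / ε ^ 2)) * (3 * D) :=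
        mul_le_mul hq hd (Nat.cast_nonneg _) (by positivity)
    _ = _ := by ring

theorem powerDegree_mul_shots_pow_le {δ ε η h : ℝ} (h0 : 0 < δ) (h1 : δ ≤ 1) (hε : 0 < ε)
    (hε1 : ε ≤ 1) (hη : 0 < η) (hη1 : η < 1) (hh : 0 ≤ h) (hh2 : h ≤ 2) :
    ((shots (h ^ powerDegree δ ε) (ε / 2) η * powerDegree δ ε : ℕ) : ℝ) ≤
      2000 * Real.log (2 / η) * (Real.log (2 / ε) / δ) *
        max 1 (h ^ (2 * (Real.log (2 / ε) / δ)) / ε ^ 2) := by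
  refine (powerDegree_mul_shots_le h0 h1 hε hε1 hη hη1).trans ?_
  have hL := half_le_log_two_div hε hε1
  have hΛ := half_le_log_two_div hη hη1.le
  set D := Real.log (2 / ε) / δ with hD
  set Λ := Real.log (2 / η)
  have hD0 : 0 < D := div_pos (by linarith) h0
  have hR := sq_pow_le_four_mul_rpow (d := powerDegree δ ε) hh hh2 hD0 (Nat.le_ceil D)
    (Nat.ceil_lt_add_one hD0.le).le
  set X := max 1 (h ^ (2 * D) / ε ^ 2) with hX
  have hX1 : 1 ≤ X := le_max_left _ _
  have hmax : max 1 ((h ^ powerDegree δ ε) ^ 2 / ε ^ 2) ≤ 4 * X := by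
    refine max_le (by linarith) ?_
    calc (h ^ powerDegree δ ε) ^ 2 / ε ^ 2 ≤ 4 * h ^ (2 * D) / ε ^ 2 := by gcongr
      _ = 4 * (h ^ (2 * D) / ε ^ 2) := by ring
      _ ≤ 4 * X := by
        gcongr
        exact le_max_right _ _
  calc 30 * Λ * D * max 1 ((h ^ powerDegree δ ε) ^ 2 / ε ^ 2)
      ≤ 30 * Λ * D * (4 * X) := mul_le_mul_of_nonneg_left hmax (by positivity)
    _ = 120 * (Λ * D * X) := by ring
    -- The value 2000 is dictated by CBNE-Chebyshev, which shares the constant.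
    _ ≤ 2000 * (Λ * D * X) := by gcongr; norm_num
    _ = 2000 * Λ * D * X := by ring

theorem max_one_rpow_div_le {h D ε : ℝ} (hh : 0 ≤ h) (hh2 : h ≤ 2) (hD : 0 ≤ D) (hε : 0 < ε)
    (hε1 : ε ≤ 1) : max 1 (h ^ (2 * D) / ε ^ 2) ≤ 2 ^ (2 * D) / ε ^ 2 := by
  refine max_le ?_ ?_
  · rw [le_div_iff₀ (by positivity), one_mul]
    exact (pow_le_one₀ hε.le hε1).trans (Real.one_le_rpow one_le_two (by positivity))
  · gcongr

/-- The polynomial factor in the query bound of CBNE-Power. -/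
noncomputable def powerQueryPoly : MvPolynomial (Fin 3) ℝ :=
  MvPolynomial.C 4000 * MvPolynomial.X 1 ^ 3 * MvPolynomial.X 2

/-- The polynomial factor in the query bound of CBNE-Chebyshev. -/
noncomputable def chebQueryPoly : MvPolynomial (Fin 3) ℝ :=
  MvPolynomial.C (2000 * 256 * 32) * MvPolynomial.X 1 ^ 6 * MvPolynomial.X 2 ^ 2

theorem power_bound_le_poly {δ ε Λ x : ℝ} (h0 : 0 < δ) (hε : 0 < ε)
    (hε1 : ε ≤ 1) (hΛ : 0 ≤ Λ) :
    2000 * Λ * (Real.log (2 / ε) / δ) * ((2 : ℝ) ^ (2 * (Real.log (2 / ε) / δ)) / ε ^ 2) ≤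
      Λ * MvPolynomial.eval ![x, 1 / ε, 1 / δ] powerQueryPoly *
        (2 : ℝ) ^ (7 * (Real.log (2 / ε) / δ)) := by
  have hL := half_le_log_two_div hε hε1
  have hlog : Real.log (2 / ε) ≤ 2 / ε := Real.log_le_self (by positivity)
  have hD : Real.log (2 / ε) / δ ≤ 2 / ε / δ := by gcongr
  have hD0 : 0 < Real.log (2 / ε) / δ := div_pos (by linarith) h0
  set D := Real.log (2 / ε) / δ
  have e : MvPolynomial.eval ![x, 1 / ε, 1 / δ] powerQueryPoly =
      4000 * (1 / ε) ^ 3 * (1 / δ) := by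
    simp [powerQueryPoly]
  rw [e]
  calc 2000 * Λ * D * ((2 : ℝ) ^ (2 * D) / ε ^ 2)
      ≤ 2000 * Λ * (2 / ε / δ) * ((2 : ℝ) ^ (7 * D) / ε ^ 2) := by
        gcongr
        · norm_num
        · norm_num
    _ = _ := by
        field_simp
        ring

variable {δ ε η : ℝ}

theorem chebDegree_bounds (h0 : 0 < δ) (h1 : δ < 1) (hε : 0 < ε) (hε1 : ε ≤ 1) :
    1 ≤ Real.log (4 / ε) / √δ ∧ Real.log (4 / ε) / √δ ≤ chebDegree δ ε ∧
      (chebDegree δ ε : ℝ) ≤ Real.log (4 / ε) / √δ + 1 := by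
  have hM := one_le_log_four_div hε hε1
  have hs : 0 < √δ := Real.sqrt_pos.2 h0
  have hD : 1 ≤ Real.log (4 / ε) / √δ :=
    hM.trans (le_div_self (by linarith) hs (Real.sqrt_le_one.2 h1.le))
  exact ⟨hD, Nat.le_ceil _, (Nat.ceil_lt_add_one (by linarith)).le⟩

theorem ceil_half_bounds {d : ℕ} (hd : 1 ≤ d) :
    1 ≤ ⌈(d : ℝ) / 2⌉₊ ∧ ⌈(d : ℝ) / 2⌉₊ ≤ d := by
  have hd' : (1 : ℝ) ≤ d := by exact_mod_cast hd
  exact ⟨Nat.ceil_pos.2 (by positivity), Nat.ceil_le.2 (by linarith)⟩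

theorem one_sub_chebEta_pow (hη1 : η < 1) {m : ℕ} (hm : m ≠ 0)
    (h : ⌈(chebDegree δ ε : ℝ) / 2⌉₊ = m) : (1 - chebEta δ ε η) ^ m = 1 - η := by
  rw [chebEta, h, sub_sub_cancel, one_div, Real.rpow_inv_natCast_pow (by linarith) hm]

theorem chebEta_bounds (hη : 0 < η) (hη1 : η < 1) {m : ℕ} (hm : 1 ≤ m)
    (h : ⌈(chebDegree δ ε : ℝ) / 2⌉₊ = m) :
    η / m ≤ chebEta δ ε η ∧ chebEta δ ε η < 1 := by
  have hm' : (1 : ℝ) ≤ m := by exact_mod_cast hm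
  rw [chebEta, h]
  constructor
  -- Bernoulli: (1 - η)^(1/m) ≤ 1 - η/m.
  · have := rpow_one_add_le_one_add_mul_self (s := -η) (by linarith) (p := 1 / (m : ℝ))
      (by positivity) (div_le_one_of_le₀ hm' (by linarith))
    rw [← sub_eq_add_neg] at this
    have e : 1 / (m : ℝ) * -η = -(η / m) := by ring
    linarith
  · linarith [Real.rpow_pos_of_pos (by linarith : 0 < 1 - η) (1 / (m : ℝ))]

/-- With m = ⌈d/2⌉, ε_i contributes m²a_i², the logarithm of 2/η' contributes m, and each sample
costs at most d queries. Since m ≤ d ≤ 2D, this gives D⁴ = log(4/ε)⁴/δ². -/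
theorem sum_chebShots_le {R : ℕ → ℝ} {B : ℝ} (h0 : 0 < δ) (h1 : δ < 1) (hε : 0 < ε)
    (hε1 : ε ≤ 1) (hη : 0 < η) (hη1 : η < 1) (hB : 1 ≤ B) (hB2 : B ≤ 2) (hR : ∀ i, 0 ≤ R i)
    (hRB : ∀ i ≤ chebDegree δ ε, R i ≤ B ^ chebDegree δ ε) :
    ((∑ i ∈ Finset.Icc 1 (chebDegree δ ε), chebShots δ ε η R i * i : ℕ) : ℝ) ≤
      2000 * Real.log (2 / η) * (Real.log (4 / ε) ^ 4 / δ ^ 2) *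
        (coeffNorm (chebPoly δ ε) ^ 2 * B ^ (2 * (Real.log (4 / ε) / √δ)) / ε ^ 2) := by
  obtain ⟨hD1, hDd, hdD⟩ := chebDegree_bounds h0 h1 hε hε1
  have hΛ := half_le_log_two_div hη hη1.le
  have hnorm := one_le_mul_sq_coeffNorm_chebPoly (ε := ε) h0 h1
  have hDpow : (Real.log (4 / ε) / √δ) ^ 4 = Real.log (4 / ε) ^ 4 / δ ^ 2 := by
    rw [div_pow, show √δ ^ 4 = (√δ ^ 2) ^ 2 by ring, Real.sq_sqrt h0.le]
  rw [← hDpow]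
  have hsum := sum_sq_coeff_le (chebPoly δ ε) (Finset.Icc 1 (chebDegree δ ε))
  have hBd := sq_pow_le_four_mul_rpow (by linarith) hB2 (by linarith) hDd hdD
  have hBX : 1 ≤ B ^ (2 * (Real.log (4 / ε) / √δ)) := Real.one_le_rpow hB (by linarith)
  obtain ⟨m, hm⟩ : ∃ m, ⌈(chebDegree δ ε : ℝ) / 2⌉₊ = m := ⟨_, rfl⟩
  have hd1 : 1 ≤ chebDegree δ ε := by exact_mod_cast hD1.trans hDd
  obtain ⟨hm1, hmd⟩ := ceil_half_bounds hd1
  rw [hm] at hm1 hmd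
  obtain ⟨hη', hη'1⟩ := chebEta_bounds hη hη1 hm1 hm
  have hm1' : (1 : ℝ) ≤ m := by exact_mod_cast hm1
  have hη'0 : 0 < chebEta δ ε η := lt_of_lt_of_le (by positivity) hη'
  set D := Real.log (4 / ε) / √δ
  set Λ := Real.log (2 / η) with hΛdef
  set N := coeffNorm (chebPoly δ ε) ^ 2
  set X := B ^ (2 * D)
  -- Here 96 = 8·4·3: 8 from ε_i, 4 from rounding the exponent of B, 3 from log(2/η') ≤ 3mΛ.
  have hshots : ∀ i ∈ Finset.Icc 1 (chebDegree δ ε), (chebShots δ ε η R i : ℝ) ≤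
      96 * (m : ℝ) ^ 3 * Λ * X / ε ^ 2 * (chebPoly δ ε).coeff i ^ 2 + 1 := by
    intro i hi
    rw [chebShots]
    split_ifs with ha
    · rw [ha]
      simp
    · refine (shots_le hη'0 hη'1.le).trans ?_
      have hlog : Real.log (2 / chebEta δ ε η) ≤ 3 * m * Λ := by
        have l1 : Real.log (2 / chebEta δ ε η) ≤ Real.log (2 / η * m) := by
          refine Real.log_le_log (by positivity) ?_
          calc 2 / chebEta δ ε η ≤ 2 / (η / m) := by gcongr
            _ = 2 / η * m := by field_simp
        rw [Real.log_mul (by positivity) (by positivity)] at l1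
        have l2 : Real.log m ≤ m := Real.log_le_self (by positivity)
        have l3 : (m : ℝ) * 1 ≤ m * (2 * Λ) := by gcongr; linarith
        have l4 : 1 * Λ ≤ m * Λ := by gcongr
        linarith
      have hRi : R i ^ 2 ≤ 4 * X :=
        (pow_le_pow_left₀ (hR i) (hRB i (Finset.mem_Icc.1 hi).2) 2).trans hBd
      have ha' : 0 < |(chebPoly δ ε).coeff i| := abs_pos.2 ha
      have e : 2 * R i ^ 2 * Real.log (2 / chebEta δ ε η) / chebEps δ ε i ^ 2 =
          8 * (m : ℝ) ^ 2 / ε ^ 2 * (chebPoly δ ε).coeff i ^ 2 *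
            (R i ^ 2 * Real.log (2 / chebEta δ ε η)) := by
        rw [chebEps, hm, ← sq_abs ((chebPoly δ ε).coeff i)]
        field_simp
        ring
      rw [e]
      have hl0 : 0 ≤ Real.log (2 / chebEta δ ε η) := by
        linarith [half_le_log_two_div hη'0 hη'1.le]
      have hmul : R i ^ 2 * Real.log (2 / chebEta δ ε η) ≤ 4 * X * (3 * m * Λ) :=
        mul_le_mul hRi hlog hl0 (by positivity)
      have := mul_le_mul_of_nonneg_left hmul
        (by positivity : 0 ≤ 8 * (m : ℝ) ^ 2 / ε ^ 2 * (chebPoly δ ε).coeff i ^ 2)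
      have e2 : 8 * (m : ℝ) ^ 2 / ε ^ 2 * (chebPoly δ ε).coeff i ^ 2 * (4 * X * (3 * m * Λ)) =
          96 * (m : ℝ) ^ 3 * Λ * X / ε ^ 2 * (chebPoly δ ε).coeff i ^ 2 := by ring
      linarith
  obtain ⟨d, hd⟩ : ∃ d, chebDegree δ ε = d := ⟨_, rfl⟩
  rw [hd] at hmd hshots hsum hnorm hdD ⊢
  have hmd' : (m : ℝ) ≤ d := by exact_mod_cast hmd
  have hd2 : (d : ℝ) ≤ 2 * D := by linarith
  push_cast
  have hε2 : ε ^ 2 ≤ 1 := pow_le_one₀ hε.le hε1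
  have hN0 : 0 ≤ N := sq_nonneg _
  calc ∑ i ∈ Finset.Icc 1 d, (chebShots δ ε η R i : ℝ) * i
      ≤ ∑ i ∈ Finset.Icc 1 d,
          (96 * (m : ℝ) ^ 3 * Λ * X / ε ^ 2 * (chebPoly δ ε).coeff i ^ 2 + 1) * d := by
        refine Finset.sum_le_sum fun i hi => ?_
        refine mul_le_mul (hshots i hi) ?_ (Nat.cast_nonneg _) (by positivity)
        exact_mod_cast (Finset.mem_Icc.1 hi).2
    _ = (96 * (m : ℝ) ^ 3 * Λ * X / ε ^ 2 *
          (∑ i ∈ Finset.Icc 1 d, (chebPoly δ ε).coeff i ^ 2) + d) * d := by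
        rw [← Finset.sum_mul, Finset.sum_add_distrib, ← Finset.mul_sum]
        simp
    _ ≤ (96 * (d : ℝ) ^ 3 * Λ * X / ε ^ 2 * N + d) * d := by gcongr
    _ = 96 * (d : ℝ) ^ 4 * Λ * (N * X / ε ^ 2) + d ^ 2 * 1 * 1 * 1 := by ring
    -- The term d² collects the ceilings. Each factor 1 in it is replaced by a quantity at least 1,
    -- to bring in ‖p‖₂², X/ε² and Λ.
    _ ≤ 96 * (2 * D) ^ 4 * Λ * (N * X / ε ^ 2) +
          (2 * D) ^ 2 * ((2 * D + 1) * N) * (X / ε ^ 2) * (2 * Λ) := by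
        have hXe : 1 ≤ X / ε ^ 2 := by
          rw [le_div_iff₀ (by positivity)]
          linarith
        have hN1 : 1 ≤ (2 * D + 1) * N := hnorm.trans (by gcongr)
        gcongr
        linarith
    _ = 1536 * Λ * D ^ 4 * (N * X / ε ^ 2) +
          (16 * D ^ 3 + 8 * D ^ 2) * (Λ * (N * X / ε ^ 2)) := by ring
    _ ≤ 1536 * Λ * D ^ 4 * (N * X / ε ^ 2) + (24 * D ^ 4) * (Λ * (N * X / ε ^ 2)) := by
        have p1 : D ^ 3 ≤ D ^ 4 := pow_le_pow_right₀ hD1 (by norm_num)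
        have p2 : D ^ 2 ≤ D ^ 4 := pow_le_pow_right₀ hD1 (by norm_num)
        gcongr
        linarith
    _ = 1560 * (Λ * D ^ 4 * (N * X / ε ^ 2)) := by ring
    _ ≤ 2000 * (Λ * D ^ 4 * (N * X / ε ^ 2)) := by gcongr; norm_num
    _ = 2000 * Λ * D ^ 4 * (N * X / ε ^ 2) := by ring

/-- The exponent 7 is 5 from ‖p‖₂² ≤ 32^d plus 2 from the power of B; rounding d up leaves a factor
32, and log(4/ε)⁴ ≤ (4/ε)⁴ gives 256. -/
theorem cheb_bound_le_poly {B x : ℝ} (h0 : 0 < δ) (h1 : δ < 1) (hε : 0 < ε)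
    (hε1 : ε ≤ 1) (hη : 0 < η) (hη1 : η < 1) (hB : 1 ≤ B) (hB2 : B ≤ 2) :
    2000 * Real.log (2 / η) * (Real.log (4 / ε) ^ 4 / δ ^ 2) *
        (coeffNorm (chebPoly δ ε) ^ 2 * B ^ (2 * (Real.log (4 / ε) / √δ)) / ε ^ 2) ≤
      Real.log (2 / η) * MvPolynomial.eval ![x, 1 / ε, 1 / δ] chebQueryPoly *
        (2 : ℝ) ^ (7 * (Real.log (4 / ε) / √δ)) := by
  obtain ⟨hD1, hDd, hdD⟩ := chebDegree_bounds h0 h1 hε hε1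
  have hΛ := half_le_log_two_div hη hη1.le
  have hM := one_le_log_four_div hε hε1
  have hlog : Real.log (4 / ε) ≤ 4 / ε := Real.log_le_self (by positivity)
  have e : MvPolynomial.eval ![x, 1 / ε, 1 / δ] chebQueryPoly =
      2000 * 256 * 32 * (1 / ε) ^ 6 * (1 / δ) ^ 2 := by
    simp [chebQueryPoly]
  have hN : coeffNorm (chebPoly δ ε) ^ 2 ≤ 32 * 2 ^ (5 * (Real.log (4 / ε) / √δ)) := by
    refine (sq_coeffNorm_chebPoly_le h0 h1).trans ?_
    calc (32 : ℝ) ^ chebDegree δ ε = 2 ^ (5 * (chebDegree δ ε : ℝ)) := by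
          rw [Real.rpow_mul two_pos.le, Real.rpow_natCast]
          norm_num
      _ ≤ 2 ^ (5 + 5 * (Real.log (4 / ε) / √δ)) :=
          Real.rpow_le_rpow_of_exponent_le one_le_two (by linarith)
      _ = 32 * 2 ^ (5 * (Real.log (4 / ε) / √δ)) := by
          rw [Real.rpow_add two_pos]
          norm_num
  have hX : B ^ (2 * (Real.log (4 / ε) / √δ)) ≤ 2 ^ (2 * (Real.log (4 / ε) / √δ)) :=
    Real.rpow_le_rpow (by linarith) hB2 (by linarith)
  set D := Real.log (4 / ε) / √δ
  have hexp : (2 : ℝ) ^ (5 * D) * 2 ^ (2 * D) = 2 ^ (7 * D) := by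
    rw [← Real.rpow_add two_pos]
    congr 1
    ring
  rw [e]
  calc 2000 * Real.log (2 / η) * (Real.log (4 / ε) ^ 4 / δ ^ 2) *
        (coeffNorm (chebPoly δ ε) ^ 2 * B ^ (2 * D) / ε ^ 2)
      ≤ 2000 * Real.log (2 / η) * ((4 / ε) ^ 4 / δ ^ 2) *
        (32 * 2 ^ (5 * D) * 2 ^ (2 * D) / ε ^ 2) := by gcongr
    _ = 2000 * Real.log (2 / η) * ((4 / ε) ^ 4 / δ ^ 2) * (32 * 2 ^ (7 * D) / ε ^ 2) := by
        rw [mul_assoc 32, hexp]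
    _ = _ := by
        field_simp
        ring

end Counting

/-! ### Correctness of the algorithms -/

section Correctness

open QueryProg

variable {n k : ℕ} {G : SimpleGraph (Fin n)} {δ ε η : ℝ}

theorem surely_sampleTrace_reflLaplacian (d : ℕ) :
    (sampleTrace d).Surely (reflLaplacian G k) fun y =>
      |y| ≤ oneNorm (reflLaplacian G k) ^ d :=
  surely_sampleTrace _ (oneNorm_nonneg _) (sum_abs_row_reflLaplacian_le_oneNorm G k) d

theorem one_sub_pow_powerDegree_le (h0 : 0 < δ) (hε : 0 < ε) {x : ℝ} (hx0 : 0 ≤ x)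
    (hx : x ≤ 1 - δ) : x ^ powerDegree δ ε ≤ ε / 2 := by
  have hd : Real.log (2 / ε) ≤ powerDegree δ ε * δ :=
    (div_le_iff₀ h0).1 (Nat.le_ceil (Real.log (2 / ε) / δ))
  calc x ^ powerDegree δ ε ≤ Real.exp (-δ) ^ powerDegree δ ε :=
        pow_le_pow_left₀ hx0 (by linarith [Real.add_one_le_exp (-δ)]) _
    _ = Real.exp (-(powerDegree δ ε * δ)) := by
        rw [← Real.exp_nat_mul]
        ring_nf
    _ ≤ Real.exp (-Real.log (2 / ε)) := Real.exp_le_exp.2 (by linarith)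
    _ = ε / 2 := by
        rw [Real.exp_neg, Real.exp_log (by positivity), inv_div]

/-- The error splits into ε/2 from the spectral approximation and ε/2 from sampling. -/
theorem estimates_cbnePower [Nonempty (Simplex G k)] (hδ : IsGapBound G k δ) (hε : 0 < ε) (hη : 0 < η) (hη1 : η < 1)
    {R : ℝ} (hR : oneNorm (reflLaplacian G k) ^ powerDegree δ ε ≤ R) :
    (cbnePower δ ε η R).Estimates (reflLaplacian G k) (normalisedBetti G k) ε η := by
  have hR0 : 0 ≤ R := (pow_nonneg (oneNorm_nonneg _) _).trans hR
  have hs := (surely_sampleTrace_reflLaplacian (G := G) (k := k) (powerDegree δ ε)).mono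
    fun y hy => hy.trans hR
  have h := prob_estimateSparseTrace_shots_le _ hR0 (half_pos hε) hη hη1 hs
  have hspec := abs_trace_sub_normalisedBetti_le (f := fun x => x ^ powerDegree δ ε) hδ
    (half_pos hε).le (one_pow _) fun x hx0 hx => by
      rw [abs_of_nonneg (pow_nonneg hx0 _)]
      exact one_sub_pow_powerDegree_le hδ.1 hε hx0 hx
  rw [← trace_reflLaplacian_pow, ← expect_sampleTrace] at hspec
  refine estimates_of_prob _ ((prob_mono _ _ fun x hx => ?_).trans h)
  have := abs_sub_le x ((sampleTrace (powerDegree δ ε)).expect (reflLaplacian G k) fun y => y)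
    (normalisedBetti G k)
  linarith

theorem trace_chebPoly [Nonempty (Simplex G k)] (H : Simplex G k → ℝ) :
    (chebPoly δ ε).coeff 0 + ∑ i ∈ Finset.Icc 1 (chebDegree δ ε), (chebPoly δ ε).coeff i *
      ((∑ j, (1 - H j) ^ i) / Fintype.card (Simplex G k)) =
    (∑ j, (chebPoly δ ε).eval (1 - H j)) / Fintype.card (Simplex G k) := by
  have hN : (Fintype.card (Simplex G k) : ℝ) ≠ 0 := by exact_mod_cast Fintype.card_ne_zero
  simp only [Polynomial.eval_eq_sum_range' (Nat.lt_succ_of_le natDegree_chebPoly_le)]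
  rw [Finset.sum_comm, Finset.sum_div, Finset.range_eq_Ico, Finset.sum_eq_sum_Ico_succ_bot
    (Nat.succ_pos _)]
  congr 1
  · simp [hN]
  · refine Finset.sum_congr rfl fun i _ => ?_
    rw [← Finset.mul_sum, mul_div_assoc]

theorem estimates_cbneChebyshev [Nonempty (Simplex G k)] (hδ : IsGapBound G k δ) (h1 : δ < 1) (hε : 0 < ε) (hε1 : ε ≤ 1)
    (hη : 0 < η) (hη1 : η < 1) {R : ℕ → ℝ}
    (hR : ∀ i, 1 ≤ i → i ≤ chebDegree δ ε → oneNorm (reflLaplacian G k) ^ i ≤ R i) :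
    (cbneChebyshev δ ε η R).Estimates (reflLaplacian G k) (normalisedBetti G k) ε η := by
  obtain ⟨hD1, hDd, -⟩ := chebDegree_bounds hδ.1 h1 hε hε1
  have hd1 : 1 ≤ chebDegree δ ε := by exact_mod_cast hD1.trans hDd
  obtain ⟨m, hm⟩ : ∃ m, ⌈(chebDegree δ ε : ℝ) / 2⌉₊ = m := ⟨_, rfl⟩
  have hm1 := (ceil_half_bounds hd1).1
  rw [hm] at hm1
  have hm' : (0 : ℝ) < m := by exact_mod_cast hm1
  obtain ⟨hη', hη'1⟩ := chebEta_bounds hη hη1 hm1 hm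
  have hη'0 : 0 < chebEta δ ε η := lt_of_lt_of_le (by positivity) hη'
  have hcard := card_coeff_chebPoly_ne_zero_le (δ := δ) (ε := ε)
  rw [hm] at hcard
  have hprob := prob_polyEstimate_ge (reflLaplacian G k) (a := fun i => (chebPoly δ ε).coeff i)
    (q := chebShots δ ε η R) (e := ε / (2 * m)) hη'1.le
    (μ := fun i => (∑ j, (1 - lapEigenvalues G k j) ^ i) / Fintype.card (Simplex G k))
    (fun i hi ha => by
      have hid : i ≤ chebDegree δ ε :=
        (Polynomial.le_natDegree_of_ne_zero ha).trans natDegree_chebPoly_le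
      have ha' : 0 < |(chebPoly δ ε).coeff i| := abs_pos.2 ha
      have he : chebEps δ ε i = ε / (2 * m) / |(chebPoly δ ε).coeff i| := by
        rw [chebEps, hm, div_div]
      rw [chebShots, if_neg ha, ← trace_reflLaplacian_pow, ← expect_sampleTrace, ← he]
      refine prob_estimateSparseTrace_shots_le _ ((pow_nonneg (oneNorm_nonneg _) _).trans
        (hR i hi hid)) (by rw [he]; positivity) hη'0 hη'1 ?_
      exact (surely_sampleTrace_reflLaplacian i).mono fun y hy => hy.trans (hR i hi hid))
    (chebDegree δ ε)
  rw [trace_chebPoly] at hprob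
  have hT := two_div_lt_eval_T hδ.1 h1 hε
  have hT0 := (div_pos two_pos hε).trans hT
  have hspec := abs_trace_sub_normalisedBetti_le (f := fun x => (chebPoly δ ε).eval x) hδ
    (one_div_pos.2 hT0).le (eval_chebPoly_one hδ.1 h1)
    fun x hx0 hx => abs_eval_chebPoly_le hδ.1 h1 hx0 hx
  have hlt : 1 / (Polynomial.Chebyshev.T ℝ (chebDegree δ ε : ℤ)).eval (1 / (1 - δ)) < ε / 2 := by
    rw [div_lt_iff₀ hT0]
    rw [div_lt_iff₀ hε] at hT
    linarith
  refine estimates_of_prob _ ?_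
  have hgood : 1 - η ≤ (cbneChebyshev δ ε η R).prob (reflLaplacian G k)
      fun x => ¬ ε ≤ |x - normalisedBetti G k| := by
    rw [← one_sub_chebEta_pow hη1 (Nat.one_le_iff_ne_zero.1 hm1) hm]
    -- Fewer estimates than ⌈d/2⌉ can only raise the product of success probabilities.
    refine (pow_le_pow_of_le_one (by linarith) (by linarith) hcard).trans
      (hprob.trans (prob_mono _ _ fun x hx => ?_))
    have hle : (((Finset.Icc 1 (chebDegree δ ε)).filter
        fun i => (chebPoly δ ε).coeff i ≠ 0).card : ℝ) * (ε / (2 * m)) ≤ ε / 2 := by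
      calc _ ≤ (m : ℝ) * (ε / (2 * m)) := by gcongr
        _ = ε / 2 := by field_simp
    rw [not_le]
    -- The sampling error may equal ε/2, so the strict spectral bound is what keeps the total below
    -- ε.
    exact (abs_sub_le x _ _).trans_lt
      ((add_lt_add_of_le_of_lt (hx.trans hle) (hspec.trans_lt hlt)).trans_eq (add_halves ε))
  rw [prob_not] at hgood
  linarith

end Correctness

/-! ### Assembly of the correctness and query bounds. -/

theorem mainTheorem7 :
    ∃ (C c : ℝ) (P Q : MvPolynomial (Fin 3) ℝ),
      ∀ (n k : ℕ) (G : SimpleGraph (Fin n)) [Nonempty (Simplex G k)] (δ ε η : ℝ),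
        1 ≤ k → IsGapBound G k δ → 0 < ε → ε ≤ 1 → 0 < η → η < 1 →
        oneNorm (reflLaplacian G k) ≤ 2 ∧
        -- CBNE-Power, sample number computed from the bound `‖H‖₁ ^ d`
        (cbnePower δ ε η (oneNorm (reflLaplacian G k) ^ powerDegree δ ε)).Estimates
          (reflLaplacian G k) (normalisedBetti G k) ε η ∧
        (cbnePower δ ε η (oneNorm (reflLaplacian G k) ^ powerDegree δ ε)).QueriesAtMost
          (reflLaplacian G k)
          (C * Real.log (2 / η) * (Real.log (2 / ε) / δ) *
            max 1 (oneNorm (reflLaplacian G k) ^ (2 * (Real.log (2 / ε) / δ)) / ε ^ 2)) ∧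
        (cbnePower δ ε η (oneNorm (reflLaplacian G k) ^ powerDegree δ ε)).QueriesAtMost
          (reflLaplacian G k)
          (C * Real.log (2 / η) * (Real.log (2 / ε) / δ) *
            ((2 : ℝ) ^ (2 * (Real.log (2 / ε) / δ)) / ε ^ 2)) ∧
        (cbnePower δ ε η (oneNorm (reflLaplacian G k) ^ powerDegree δ ε)).QueriesAtMost
          (reflLaplacian G k)
          (Real.log (2 / η) * MvPolynomial.eval ![(n : ℝ), 1 / ε, 1 / δ] P *
            (2 : ℝ) ^ (c * (Real.log (2 / ε) / δ))) ∧
        -- CBNE-Power, sample number computed from the bound `2 ^ d`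
        (cbnePower δ ε η (2 ^ powerDegree δ ε)).Estimates
          (reflLaplacian G k) (normalisedBetti G k) ε η ∧
        (cbnePower δ ε η (2 ^ powerDegree δ ε)).QueriesAtMost (reflLaplacian G k)
          (C * Real.log (2 / η) * (Real.log (2 / ε) / δ) *
            ((2 : ℝ) ^ (2 * (Real.log (2 / ε) / δ)) / ε ^ 2)) ∧
        (cbnePower δ ε η (2 ^ powerDegree δ ε)).QueriesAtMost (reflLaplacian G k)
          (Real.log (2 / η) * MvPolynomial.eval ![(n : ℝ), 1 / ε, 1 / δ] P *
            (2 : ℝ) ^ (c * (Real.log (2 / ε) / δ))) ∧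
        (δ < 1 →
          -- CBNE-Chebyshev, sample numbers computed from the bounds `‖H‖₁ ^ i`
          (cbneChebyshev δ ε η (fun i => oneNorm (reflLaplacian G k) ^ i)).Estimates
            (reflLaplacian G k) (normalisedBetti G k) ε η ∧
          (cbneChebyshev δ ε η (fun i => oneNorm (reflLaplacian G k) ^ i)).QueriesAtMost
            (reflLaplacian G k)
            (C * Real.log (2 / η) * (Real.log (4 / ε) ^ 4 / δ ^ 2) *
              (coeffNorm (chebPoly δ ε) ^ 2 *
                max 1 (oneNorm (reflLaplacian G k)) ^ (2 * (Real.log (4 / ε) / √δ)) / ε ^ 2)) ∧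
          (cbneChebyshev δ ε η (fun i => oneNorm (reflLaplacian G k) ^ i)).QueriesAtMost
            (reflLaplacian G k)
            (Real.log (2 / η) * MvPolynomial.eval ![(n : ℝ), 1 / ε, 1 / δ] Q *
              (2 : ℝ) ^ (c * (Real.log (4 / ε) / √δ))) ∧
          -- CBNE-Chebyshev, sample numbers computed from the common bound `2 ^ d`
          (cbneChebyshev δ ε η (fun _ => 2 ^ chebDegree δ ε)).Estimates
            (reflLaplacian G k) (normalisedBetti G k) ε η ∧
          (cbneChebyshev δ ε η (fun _ => 2 ^ chebDegree δ ε)).QueriesAtMost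
            (reflLaplacian G k)
            (C * Real.log (2 / η) * (Real.log (4 / ε) ^ 4 / δ ^ 2) *
              (coeffNorm (chebPoly δ ε) ^ 2 *
                (2 : ℝ) ^ (2 * (Real.log (4 / ε) / √δ)) / ε ^ 2)) ∧
          (cbneChebyshev δ ε η (fun _ => 2 ^ chebDegree δ ε)).QueriesAtMost
            (reflLaplacian G k)
            (Real.log (2 / η) * MvPolynomial.eval ![(n : ℝ), 1 / ε, 1 / δ] Q *
              (2 : ℝ) ^ (c * (Real.log (4 / ε) / √δ)))) := by
  refine ⟨2000, 7, powerQueryPoly, chebQueryPoly, ?_⟩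
  intro n k G _ δ ε η _ hδ hε hε1 hη hη1
  have h0 := hδ.1
  have hle := hδ.le_one
  have hH0 := oneNorm_nonneg (reflLaplacian G k)
  have hH2 := oneNorm_reflLaplacian_le_two G k
  have hΛ : 0 ≤ Real.log (2 / η) := by linarith [half_le_log_two_div hη hη1.le]
  have hD : 0 ≤ Real.log (2 / ε) / δ :=
    div_nonneg (by linarith [half_le_log_two_div hε hε1]) h0.le
  have hpow : ∀ {h : ℝ}, 0 ≤ h → h ≤ 2 →
      ((shots (h ^ powerDegree δ ε) (ε / 2) η * powerDegree δ ε : ℕ) : ℝ) ≤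
        2000 * Real.log (2 / η) * (Real.log (2 / ε) / δ) *
          ((2 : ℝ) ^ (2 * (Real.log (2 / ε) / δ)) / ε ^ 2) := fun hh hh2 =>
    (powerDegree_mul_shots_pow_le h0 hle hε hε1 hη hη1 hh hh2).trans
      (mul_le_mul_of_nonneg_left (max_one_rpow_div_le hh hh2 hD hε hε1) (by positivity))
  have hpoly := power_bound_le_poly (x := n) h0 hε hε1 hΛ
  have hcost := fun R => costs_estimateSparseTrace (reflLaplacian G k) (powerDegree δ ε)
    (shots R (ε / 2) η)
  refine ⟨hH2, estimates_cbnePower hδ hε hη hη1 le_rfl,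
    (hcost _).queriesAtMost _ (powerDegree_mul_shots_pow_le h0 hle hε hε1 hη hη1 hH0 hH2),
    (hcost _).queriesAtMost _ (hpow hH0 hH2),
    (hcost _).queriesAtMost _ ((hpow hH0 hH2).trans hpoly),
    estimates_cbnePower hδ hε hη hη1 (pow_le_pow_left₀ hH0 hH2 _),
    (hcost _).queriesAtMost _ (hpow zero_le_two le_rfl),
    (hcost _).queriesAtMost _ ((hpow zero_le_two le_rfl).trans hpoly), fun h1 => ?_⟩
  have hcost := fun R => costs_polyEstimate (reflLaplacian G k)
    (fun i => (chebPoly δ ε).coeff i) (chebShots δ ε η R) (chebDegree δ ε)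
  have hB1 := le_max_left 1 (oneNorm (reflLaplacian G k))
  have hBH := le_max_right 1 (oneNorm (reflLaplacian G k))
  have hB2 : max 1 (oneNorm (reflLaplacian G k)) ≤ 2 := max_le one_le_two hH2
  have hsum := sum_chebShots_le (R := fun i => oneNorm (reflLaplacian G k) ^ i) h0 h1 hε hε1 hη
    hη1 hB1 hB2 (fun i => pow_nonneg hH0 i) fun i hi =>
      (pow_le_pow_left₀ hH0 hBH i).trans (pow_le_pow_right₀ hB1 hi)
  have hsum2 := sum_chebShots_le (R := fun _ => 2 ^ chebDegree δ ε) h0 h1 hε hε1 hη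
    hη1 one_le_two le_rfl (fun _ => by positivity) fun _ _ => le_rfl
  exact ⟨estimates_cbneChebyshev hδ h1 hε hε1 hη hη1 fun _ _ _ => le_rfl,
    (hcost _).queriesAtMost _ hsum,
    (hcost _).queriesAtMost _
      (hsum.trans (cheb_bound_le_poly h0 h1 hε hε1 hη hη1 hB1 hB2)),
    estimates_cbneChebyshev hδ h1 hε hε1 hη hη1 fun i _ hi =>
      (pow_le_pow_left₀ hH0 hH2 i).trans (pow_le_pow_right₀ one_le_two hi),
    (hcost _).queriesAtMost _ hsum2,
    (hcost _).queriesAtMost _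
      (hsum2.trans (cheb_bound_le_poly h0 h1 hε hε1 hη hη1 one_le_two le_rfl))⟩
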